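/- Let $f$ be a non-constant holomorphic function in a neighbourhood of $0\in\mathbb C$ with $f(0)=0$ and local index $i(0,f)=d\ge 2$, where $i(0,f)=\inf_V\sup_{w}\operatorname{card}\big(f^{-1}(w)\cap V\big)$, the infimum being over all neighbourhoods $V$ of $0$. For small $r>0$ let $$\rho_f(r)=\left(\frac{|f(B(0,r))|}{\pi}\right)^{1/2},$$ where $|\cdot|$ is the area of a set, and put $\rho_f(0)=0$. Then $f$ is simple at $0$: there is exactly one map $g:\mathbb C\to\mathbb C$ which is the locally uniform limit of $z\mapsto f(r_kz)/\rho_f(r_k)$ along some decreasing sequence of positive numbers $r_k\to0$. Moreover the asymptotic representative $$\mathcal D(z)=\rho_f(|z|)\,g(z/|z|)\quad(z\neq 0),\qquad \mathcal D(0)=0,$$ of $f$ at $0$ is smoothly conjugate to $z\mapsto z^d$ near $0$, in the following sense: there are open neighbourhoods $V,W$ of $0$ with $\mathcal D(V)\subset V$ and a homeomorphism $H:V\to W$ with $H(0)=0$ such that $$H(\mathcal D(z))=H(z)^d\qquad\text{for all } z\in V,$$ and both $H$ and $H^{-1}$ are $C^1$, are $C^\infty$ away from $0$, and are $C^\infty$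 functions of the polar coordinates $(r,\theta)$, $r\ge 0$, of their argument $re^{i\theta}$, up to and including $r=0$. -/

import Mathlib

open Filter Topology MeasureTheory
open scoped ContDiff

noncomputable section

/-- The local index `i(z₀, f)`: the infimum over all neighbourhoods `V` of `z₀` of
`sup_w card (f⁻¹(w) ∩ V)`, with values in `ℕ ∪ {∞}`. -/
def localIndex (f : ℂ → ℂ) (z₀ : ℂ) : ℕ∞ :=
  ⨅ V ∈ 𝓝 z₀, ⨆ w : ℂ, (f ⁻¹' {w} ∩ V).encard

/-- The mean radius `ρ_f(r) = (|f(B(z₀, r))| / π)^{1/2}` of the image of the open disk `B(z₀, r)`;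
here `|·|` is the area of the image as a set (points are not counted with multiplicity). -/
def meanRadius (f : ℂ → ℂ) (z₀ : ℂ) (r : ℝ) : ℝ :=
  Real.sqrt (volume.real (f '' Metric.ball z₀ r) / Real.pi)

/-- The rescaled map `f_r(z) = (f(z₀ + r z) - f(z₀)) / ρ_f(r)`. -/
def rescaling (f : ℂ → ℂ) (z₀ : ℂ) (r : ℝ) (z : ℂ) : ℂ :=
  (f (z₀ + r * z) - f z₀) / (meanRadius f z₀ r : ℂ)

/-- The infinitesimal space `T(z₀, f)`: all maps `g : ℂ → ℂ` that are locally uniform limits of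
`f_{r_k}` along some decreasing sequence of positive radii `r_k → 0`. On a compact set the maps
`f_{r_k}` with `k` large only see the germ of `f` at `z₀`. -/
def infinitesimalSpace (f : ℂ → ℂ) (z₀ : ℂ) : Set (ℂ → ℂ) :=
  {g | ∃ r : ℕ → ℝ, (∀ k, 0 < r k) ∧ StrictAnti r ∧ Tendsto r atTop (𝓝 0) ∧
    TendstoLocallyUniformly (fun k => rescaling f z₀ (r k)) g atTop}

/-- The map `D(z) = ρ_f(|z|) g(z / |z|)`. It is the asymptotic representative of `f` at `0` when
`f(0) = 0` and `g` is the only element of `T(0, f)`. At `z = 0` the value is `0`, as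
`ρ_f(0) = 0`. -/
def asymptoticRepresentative (f g : ℂ → ℂ) (z : ℂ) : ℂ :=
  (meanRadius f 0 ‖z‖ : ℂ) * g (z / (‖z‖ : ℂ))

/-- Regularity of a planar map `G` on an open set `V`: it is `C^1` on `V`, `C^∞` on
`V \ {0}`, and `C^∞` in polar coordinates `(r, θ)`, `r ≥ 0`, up to and including `r = 0`.
For `G(r e^{iθ}) = h(r) e^{iθ}` on a disk this says that `h` is `C^∞` on `[0, r₀)` with
`h(0) = 0`. -/
def SmoothInPolar (G : ℂ → ℂ) (V : Set ℂ) : Prop :=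
  ContDiffOn ℝ 1 G V ∧
  ContDiffOn ℝ ∞ G (V \ {0}) ∧
  ContDiffOn ℝ ∞ (fun p : ℝ × ℝ => G (p.1 * Complex.exp (p.2 * Complex.I)))
    {p : ℝ × ℝ | 0 ≤ p.1 ∧ (p.1 * Complex.exp (p.2 * Complex.I) : ℂ) ∈ V}

/-- `F` and `G` are smoothly conjugate near `0`: there is a homeomorphism `H` from an open
neighbourhood of `0` onto an open neighbourhood of `0`, fixing `0`, smooth together with its
inverse, whose source is mapped into itself by `F` and with `H ∘ F = G ∘ H` there. -/
def SmoothlyConjugateAtZero (F G : ℂ → ℂ) : Prop :=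
  ∃ H : OpenPartialHomeomorph ℂ ℂ, (0 : ℂ) ∈ H.source ∧ H 0 = 0 ∧
    SmoothInPolar H H.source ∧ SmoothInPolar H.symm H.target ∧
    ∀ z ∈ H.source, F z ∈ H.source ∧ H (F z) = G (H z)

end

/-!
Near `0` the map is a power `f = φ ^ d` of a local coordinate `φ` with inverse `ψ`, and the exponent
`d` is the local index. Comparing `f (B(0, r))` with disks gives `ρ_f(r) / r ^ d → |φ'(0)| ^ d`, so
the rescaled maps converge to `c z ^ d`, where `c` is the leading coefficient of `f` divided by its
modulus. Hence the asymptotic representative is `r e^{iθ} ↦ ρ_f(r) c e^{idθ}`, and the content of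
the theorem is that `ρ_f` is smooth up to `r = 0`, together with a linearisation of the radial
dynamics `r ↦ ρ_f(r)`.

*Smoothness of `ρ_f`.* The area counts each value once, although it may be taken several times in a
disk. Selecting for every value the preimage of least modulus, one gets
`|f (B(0, r))| = ∑_j ∫_{B(0, r) ∩ T_j} |f'|²` with sets `T_j` that do not depend on `r`
(`minimalCell`, `IsRootDomain.volume_image_ball`). The preimages of `f z` are the points
`σ z = ψ (η φ z)`, `η ^ d = 1`, and `|z| ≤ |σ z|` says that the harmonic function
`Re log (σ z / (η z))`, which vanishes at `0`, is non-negative. Near a zero, and unless the function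
vanishes identically, the zero set of a harmonic function is a union of curves along which the angle
is a real-analytic function of `r ≥ 0` (`isAnalyticSector_of_re`); two such curves are in a fixed
order for small `r > 0`. So on a small circle `T_j` consists of arcs whose ends depend analytically
on `r`, the angular integral of `|f'|²` over `T_j` is analytic in `r`
(`hasAnalyticAngularIntegral`), and polar coordinates give
`ρ_f(r) = r ^ d σ(r)` with `σ` real-analytic at `0` and `σ(0) > 0`
(`LocalRoot.exists_analyticAt_meanRadius`).

*Conjugacy.* As `d ≥ 2`, the origin is a superattracting fixed point of the holomorphic extension of
`ρ_f`, and its Böttcher coordinate `h(r) = r e(r)` is analytic with `h ∘ ρ_f = h ^ d`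
(`exists_boettcher`). The homeomorphism `H (r e^{iθ}) = κ h(r) e^{iθ}` with `κ ^ (d - 1) = c`
conjugates the asymptotic representative to `z ^ d`. Both `H` and its inverse have the form
`z ↦ κ z e(|z|)` with `e` real-analytic, which yields the required regularity
(`smoothInPolar_radialMap`).
-/

/-! ### The local normal form and the local index -/

theorem AnalyticAt.dslope_zero {𝕜 : Type*} [NontriviallyNormedField 𝕜] {F : 𝕜 → 𝕜}
    (hF : AnalyticAt 𝕜 F 0) : AnalyticAt 𝕜 (dslope F 0) 0 := by
  obtain ⟨p, hp⟩ := hF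
  exact ⟨_, hp.has_fpower_series_dslope_fslope⟩

theorem eq_mul_dslope_zero {𝕜 : Type*} [NontriviallyNormedField 𝕜] {F : 𝕜 → 𝕜} (h0 : F 0 = 0)
    (z : 𝕜) : F z = z * dslope F 0 z := by
  have := sub_smul_dslope F 0 z
  simp only [sub_zero, h0, smul_eq_mul] at this
  exact this.symm

/-- A non-vanishing holomorphic germ has an `n`-th root, by means of a branch of the logarithm near
`u z / u 0 = 1`. -/
theorem exists_pow_eq_of_ne_zero {u : ℂ → ℂ} (hu : AnalyticAt ℂ u 0) (hu0 : u 0 ≠ 0) {n : ℕ}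
    (hn : n ≠ 0) : ∃ v : ℂ → ℂ, AnalyticAt ℂ v 0 ∧ v 0 ≠ 0 ∧ ∀ᶠ z in 𝓝 (0 : ℂ), u z = v z ^ n := by
  obtain ⟨b, hb⟩ : ∃ b : ℂ, b ^ n = u 0 := IsAlgClosed.exists_pow_nat_eq _ (Nat.pos_of_ne_zero hn)
  have hb0 : b ≠ 0 := by
    rintro rfl
    exact hu0 (by rw [← hb, zero_pow hn])
  have hn' : (n : ℂ) ≠ 0 := by exact_mod_cast hn
  have hq : AnalyticAt ℂ (fun z => u z / u 0) 0 := hu.div_const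
  have hq0 : (fun z => u z / u 0) 0 ∈ Complex.slitPlane := by
    simp [div_self hu0]
  refine ⟨fun z => b * Complex.exp (Complex.log (u z / u 0) / n), ?_, ?_, ?_⟩
  · exact analyticAt_const.mul ((hq.clog hq0).div_const.cexp)
  · exact mul_ne_zero hb0 (Complex.exp_ne_zero _)
  · filter_upwards [hu.continuousAt.eventually_ne hu0] with z hz
    rw [mul_pow, hb, ← Complex.exp_nat_mul, mul_div_cancel₀ _ hn',
      Complex.exp_log (div_ne_zero hz hu0), mul_div_cancel₀ _ hu0]

/-- Near a zero a non-constant holomorphic function is a power `φ ^ n` of a local coordinate `φ`;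
`ψ` is the inverse of the coordinate. -/
structure LocalRoot (f : ℂ → ℂ) (n : ℕ) (φ ψ : ℂ → ℂ) : Prop where
  analytic : AnalyticAt ℂ φ 0
  analytic_inv : AnalyticAt ℂ ψ 0
  map_zero : φ 0 = 0
  inv_zero : ψ 0 = 0
  left_inv : ∀ᶠ z in 𝓝 (0 : ℂ), ψ (φ z) = z
  right_inv : ∀ᶠ w in 𝓝 (0 : ℂ), φ (ψ w) = w
  pow_eq : ∀ᶠ z in 𝓝 (0 : ℂ), f z = φ z ^ n

theorem exists_localRoot {f : ℂ → ℂ} (hf : AnalyticAt ℂ f 0)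
    (hconst : ¬ ∀ᶠ z in 𝓝 (0 : ℂ), f z = f 0) (h0 : f 0 = 0) :
    ∃ n φ ψ, n ≠ 0 ∧ LocalRoot f n φ ψ := by
  rw [h0] at hconst
  obtain ⟨n, u, hu, hu0, hfu⟩ := hf.exists_eventuallyEq_pow_smul_nonzero_iff.2 hconst
  have hn : n ≠ 0 := by
    rintro rfl
    have := hfu.self_of_nhds
    simp only [pow_zero, one_smul] at this
    exact hu0 (this ▸ h0)
  obtain ⟨v, hv, hv0, huv⟩ := exists_pow_eq_of_ne_zero hu hu0 hn
  have hφ : AnalyticAt ℂ (fun z => z * v z) 0 := analyticAt_id.mul hv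
  have hd : deriv (fun z => z * v z) 0 ≠ 0 := by
    have := (hasDerivAt_id (0 : ℂ)).mul hv.differentiableAt.hasDerivAt
    simp only [id, one_mul, zero_mul, add_zero] at this
    rw [show (fun z => z * v z) = (id * v : ℂ → ℂ) from rfl, this.deriv]
    exact hv0
  have h00 : (fun z => z * v z) 0 = 0 := by simp
  refine ⟨n, fun z => z * v z, hφ.hasStrictDerivAt.localInverse _ _ _ hd, hn,
    hφ, ?_, h00, ?_, ?_, ?_, ?_⟩
  · simpa only [h00] using hφ.analyticAt_localInverse hd
  · have := HasStrictFDerivAt.localInverse_apply_image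
      (hφ.hasStrictDerivAt.hasStrictFDerivAt_equiv hd)
    simp only [zero_mul] at this
    exact this
  · exact hφ.hasStrictDerivAt.eventually_left_inverse hd
  · have := hφ.hasStrictDerivAt.eventually_right_inverse hd
    simpa only [zero_mul] using this
  · filter_upwards [hfu, huv] with z h1 h2
    rw [h1, h2, mul_pow, sub_zero, smul_eq_mul]

namespace LocalRoot

variable {f φ ψ : ℂ → ℂ} {n : ℕ}

/-- The chain rule for `ψ ∘ φ = id` at `0`. -/
theorem dslope_mul_dslope (h : LocalRoot f n φ ψ) : dslope φ 0 0 * dslope ψ 0 0 = 1 := by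
  have h1 : HasDerivAt ψ (deriv ψ 0) (φ 0) := by
    rw [h.map_zero]
    exact h.analytic_inv.differentiableAt.hasDerivAt
  have h2 := h1.comp 0 h.analytic.differentiableAt.hasDerivAt
  have h3 : HasDerivAt (ψ ∘ φ) 1 0 := (hasDerivAt_id (0 : ℂ)).congr_of_eventuallyEq h.left_inv
  rw [dslope_same, dslope_same, mul_comm]
  exact h2.unique h3

theorem dslope_ne_zero (h : LocalRoot f n φ ψ) : dslope φ 0 0 ≠ 0 :=
  left_ne_zero_of_mul_eq_one h.dslope_mul_dslope

theorem tendsto (h : LocalRoot f n φ ψ) : Tendsto φ (𝓝 0) (𝓝 0) := by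
  have := h.analytic.continuousAt.tendsto
  rwa [h.map_zero] at this

theorem tendsto_inv (h : LocalRoot f n φ ψ) : Tendsto ψ (𝓝 0) (𝓝 0) := by
  have := h.analytic_inv.continuousAt.tendsto
  rwa [h.inv_zero] at this

/-- The local index is the exponent of the local normal form: a small non-zero `w` has `n`
distinct `n`-th roots, and `ψ` maps them to preimages of `w`. -/
theorem localIndex_eq (h : LocalRoot f n φ ψ) (hn : n ≠ 0) : localIndex f 0 = n := by
  apply le_antisymm
  · have hV := h.left_inv.and h.pow_eq
    refine (iInf₂_le {z | ψ (φ z) = z ∧ f z = φ z ^ n} hV).trans (iSup_le fun w => ?_)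
    have hinj : Set.InjOn φ (f ⁻¹' {w} ∩ {z | ψ (φ z) = z ∧ f z = φ z ^ n}) := by
      intro x hx y hy hxy
      rw [← hx.2.1, ← hy.2.1, hxy]
    rw [← hinj.encard_image]
    have hsub : φ '' (f ⁻¹' {w} ∩ {z | ψ (φ z) = z ∧ f z = φ z ^ n}) ⊆
        ((Polynomial.nthRoots n w).toFinset : Set ℂ) := by
      rintro _ ⟨z, ⟨hz1, hz2, hz3⟩, rfl⟩
      simp only [Finset.mem_coe, Multiset.mem_toFinset]
      rw [Polynomial.mem_nthRoots (Nat.pos_of_ne_zero hn), ← hz3]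
      exact hz1
    refine (Set.encard_le_encard hsub).trans ?_
    rw [Set.encard_coe_eq_coe_finsetCard]
    exact_mod_cast (Multiset.toFinset_card_le _).trans (Polynomial.card_nthRoots n w)
  · refine le_iInf₂ fun V hV => ?_
    have hpf : ∀ᶠ w in 𝓝 (0 : ℂ), f (ψ w) = φ (ψ w) ^ n := h.tendsto_inv.eventually h.pow_eq
    have hW := (h.right_inv.and hpf).and (h.tendsto_inv.eventually hV)
    obtain ⟨ε, hε, hball⟩ := Metric.eventually_nhds_iff.1 hW
    set ζ := Complex.exp (2 * Real.pi * Complex.I / n) with hζ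
    have hprim : IsPrimitiveRoot ζ n := Complex.isPrimitiveRoot_exp n hn
    have hζn : ‖ζ‖ = 1 := hprim.norm'_eq_one hn
    set t : ℂ := ((ε / 2 : ℝ) : ℂ) with ht
    have htn : ‖t‖ = ε / 2 := by rw [ht, Complex.norm_real, Real.norm_of_nonneg (by positivity)]
    have ht0 : t ≠ 0 := by rw [← norm_ne_zero_iff, htn]; positivity
    have hmem : ∀ i : ℕ, dist (ζ ^ i * t) 0 < ε := by
      intro i
      rw [dist_zero_right, norm_mul, norm_pow, hζn, htn]
      simp only [one_pow, one_mul]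
      linarith
    refine le_trans ?_ (le_iSup _ (t ^ n))
    have hinj : Set.InjOn (fun i : ℕ => ψ (ζ ^ i * t)) (Finset.range n : Set ℕ) := by
      intro i hi j hj hij
      have h1 := (hball (hmem i)).1.1
      have h2 := (hball (hmem j)).1.1
      simp only at hij
      rw [hij, h2] at h1
      exact hprim.pow_inj (by simpa using hi) (by simpa using hj) (mul_right_cancel₀ ht0 h1).symm
    have hsub : (fun i : ℕ => ψ (ζ ^ i * t)) '' (Finset.range n : Set ℕ) ⊆ f ⁻¹' {t ^ n} ∩ V := by
      rintro _ ⟨i, -, rfl⟩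
      refine ⟨?_, (hball (hmem i)).2⟩
      simp only [Set.mem_preimage, Set.mem_singleton_iff]
      rw [(hball (hmem i)).1.2, (hball (hmem i)).1.1, mul_pow, ← pow_mul, mul_comm i n, pow_mul,
        hprim.pow_eq_one, one_pow, one_mul]
    refine le_trans ?_ (Set.encard_le_encard hsub)
    rw [hinj.encard_image, Set.encard_coe_eq_coe_finsetCard, Finset.card_range]

end LocalRoot

/-! ### The mean radius to leading order and the infinitesimal space -/

theorem sqrt_volume_ball_div_pi {R : ℝ} (hR : 0 ≤ R) :
    Real.sqrt (volume.real (Metric.ball (0 : ℂ) R) / Real.pi) = R := by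
  have : volume.real (Metric.ball (0 : ℂ) R) = R ^ 2 * Real.pi := by
    rw [Measure.real, Complex.volume_ball, ENNReal.toReal_mul, ENNReal.toReal_pow,
      ENNReal.toReal_ofReal hR]
    rfl
  rw [this, mul_div_cancel_right₀ _ Real.pi_ne_zero, Real.sqrt_sq hR]

theorem le_meanRadius_of_ball_subset {S : Set ℂ} {R R' : ℝ} (hR : 0 ≤ R)
    (h : Metric.ball 0 R ⊆ S) (h' : S ⊆ Metric.ball 0 R') :
    R ≤ Real.sqrt (volume.real S / Real.pi) := by
  nth_rewrite 1 [← sqrt_volume_ball_div_pi hR]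
  refine Real.sqrt_le_sqrt (div_le_div_of_nonneg_right ?_ Real.pi_pos.le)
  exact measureReal_mono h ((measure_mono h').trans_lt measure_ball_lt_top).ne

theorem meanRadius_le_of_subset_ball {S : Set ℂ} {R : ℝ} (hR : 0 ≤ R)
    (h : S ⊆ Metric.ball 0 R) : Real.sqrt (volume.real S / Real.pi) ≤ R := by
  refine le_of_le_of_eq ?_ (sqrt_volume_ball_div_pi hR)
  refine Real.sqrt_le_sqrt (div_le_div_of_nonneg_right ?_ Real.pi_pos.le)
  exact measureReal_mono h measure_ball_lt_top.ne

namespace LocalRoot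

variable {f φ ψ : ℂ → ℂ} {n : ℕ}

theorem apply_zero (h : LocalRoot f n φ ψ) (hn : n ≠ 0) : f 0 = 0 := by
  rw [h.pow_eq.self_of_nhds, h.map_zero, zero_pow hn]

/-- The inverse `ψ` takes an `n`-th root of a small `w` to a preimage of `w` under `f`. -/
theorem eventually_ball_subset_image (h : LocalRoot f n φ ψ) (hn : n ≠ 0) {l : ℝ} (hl : 1 < l) :
    ∀ᶠ r in 𝓝[>] (0 : ℝ),
      Metric.ball 0 (‖dslope φ 0 0‖ ^ n / l * r ^ n) ⊆ f '' Metric.ball 0 r := by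
  have hl0 : 0 < l := by linarith
  set c := ‖dslope φ 0 0‖ ^ n with hc
  have hc0 : 0 < c := pow_pos (norm_pos_iff.2 h.dslope_ne_zero) n
  have hv : ‖dslope ψ 0 0‖ ^ n < l / c := by
    have := congrArg (fun z => ‖z‖ ^ n) h.dslope_mul_dslope
    simp only [norm_mul, mul_pow, norm_one, one_pow] at this
    rw [lt_div_iff₀ hc0, mul_comm, this]
    exact hl
  have h1 : ∀ᶠ s in 𝓝 (0 : ℂ), ‖dslope ψ 0 s‖ ^ n < l / c :=
    (h.analytic_inv.dslope_zero.continuousAt.norm.pow n).eventually_lt_const hv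
  have h2 := (h1.and h.right_inv).and (h.tendsto_inv.eventually h.pow_eq)
  obtain ⟨ε, hε, hball⟩ := Metric.eventually_nhds_iff_ball.1 h2
  have h3 : Tendsto (fun r : ℝ => c / l * r ^ n) (𝓝[>] 0) (𝓝 0) := by
    have : Tendsto (fun r : ℝ => c / l * r ^ n) (𝓝 0) (𝓝 (c / l * 0 ^ n)) :=
      tendsto_const_nhds.mul (tendsto_id.pow n)
    rw [zero_pow hn, mul_zero] at this
    exact this.mono_left nhdsWithin_le_nhds
  filter_upwards [self_mem_nhdsWithin, h3.eventually_lt_const (pow_pos hε n)] with r hr hr2 w hw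
  obtain ⟨s, hs⟩ : ∃ s : ℂ, s ^ n = w := IsAlgClosed.exists_pow_nat_eq _ (Nat.pos_of_ne_zero hn)
  rw [mem_ball_zero_iff] at hw
  have hsn : ‖s‖ ^ n = ‖w‖ := by rw [← norm_pow, hs]
  have hsε : ‖s‖ < ε := lt_of_pow_lt_pow_left₀ n hε.le (by rw [hsn]; exact hw.trans hr2)
  obtain ⟨⟨h4, h5⟩, h6⟩ := hball s (by simpa using hsε)
  refine ⟨ψ s, ?_, ?_⟩
  · rw [mem_ball_zero_iff]
    refine lt_of_pow_lt_pow_left₀ n (le_of_lt hr) ?_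
    rw [eq_mul_dslope_zero h.inv_zero s, norm_mul, mul_pow, hsn]
    calc ‖w‖ * ‖dslope ψ 0 s‖ ^ n ≤ ‖w‖ * (l / c) := by gcongr
      _ < c / l * r ^ n * (l / c) := by
        exact mul_lt_mul_of_pos_right hw (div_pos hl0 hc0)
      _ = r ^ n := by field_simp
  · rw [h6, h5, hs]

theorem eventually_image_subset_ball (h : LocalRoot f n φ ψ) {l : ℝ} (hl : 1 < l) :
    ∀ᶠ r in 𝓝[>] (0 : ℝ),
      f '' Metric.ball 0 r ⊆ Metric.ball 0 (‖dslope φ 0 0‖ ^ n * l * r ^ n) := by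
  set c := ‖dslope φ 0 0‖ ^ n with hc
  have hc0 : 0 < c := pow_pos (norm_pos_iff.2 h.dslope_ne_zero) n
  have h1 : ∀ᶠ s in 𝓝 (0 : ℂ), ‖dslope φ 0 s‖ ^ n < c * l :=
    (h.analytic.dslope_zero.continuousAt.norm.pow n).eventually_lt_const
      (lt_mul_of_one_lt_right hc0 hl)
  obtain ⟨ε, hε, hball⟩ := Metric.eventually_nhds_iff_ball.1 (h1.and h.pow_eq)
  filter_upwards [Ioo_mem_nhdsGT hε] with r hr
  rintro _ ⟨z, hz, rfl⟩
  obtain ⟨h2, h3⟩ := hball z (Metric.ball_subset_ball hr.2.le hz)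
  rw [mem_ball_zero_iff] at hz ⊢
  rw [h3, norm_pow, eq_mul_dslope_zero h.map_zero z, norm_mul, mul_pow, mul_comm]
  calc ‖dslope φ 0 z‖ ^ n * ‖z‖ ^ n ≤ ‖dslope φ 0 z‖ ^ n * r ^ n := by gcongr
    _ < c * l * r ^ n := mul_lt_mul_of_pos_right h2 (pow_pos hr.1 n)

theorem tendsto_meanRadius (h : LocalRoot f n φ ψ) (hn : n ≠ 0) :
    Tendsto (fun r => meanRadius f 0 r / r ^ n) (𝓝[>] 0) (𝓝 (‖dslope φ 0 0‖ ^ n)) := by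
  set c := ‖dslope φ 0 0‖ ^ n with hc
  have hc0 : 0 < c := pow_pos (norm_pos_iff.2 h.dslope_ne_zero) n
  have key : ∀ l : ℝ, 1 < l → ∀ᶠ r in 𝓝[>] (0 : ℝ),
      c / l ≤ meanRadius f 0 r / r ^ n ∧ meanRadius f 0 r / r ^ n ≤ c * l := by
    intro l hl
    filter_upwards [h.eventually_ball_subset_image hn hl, h.eventually_image_subset_ball hl,
      self_mem_nhdsWithin] with r h1 h2 h3
    have h4 : 0 < r ^ n := pow_pos h3 n
    rw [le_div_iff₀ h4, div_le_iff₀ h4]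
    exact ⟨le_meanRadius_of_ball_subset (by positivity) h1 h2,
      meanRadius_le_of_subset_ball (by positivity) h2⟩
  rw [tendsto_order]
  constructor
  · intro b hb
    obtain ⟨l, hl1, hl2⟩ : ∃ l : ℝ, 1 < l ∧ b < c / l := by
      have h1 : Tendsto (fun l : ℝ => c / l) (𝓝[>] 1) (𝓝 c) := by
        have : Tendsto (fun l : ℝ => c / l) (𝓝 1) (𝓝 (c / 1)) :=
          tendsto_const_nhds.div tendsto_id one_ne_zero
        rw [div_one] at this
        exact this.mono_left nhdsWithin_le_nhds
      exact (eventually_mem_nhdsWithin.and (h1.eventually_const_lt hb)).exists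
    filter_upwards [key l hl1] with r hr
    exact hl2.trans_le hr.1
  · intro b hb
    obtain ⟨l, hl1, hl2⟩ : ∃ l : ℝ, 1 < l ∧ c * l < b := by
      have h1 : Tendsto (fun l : ℝ => c * l) (𝓝[>] 1) (𝓝 c) := by
        have : Tendsto (fun l : ℝ => c * l) (𝓝 1) (𝓝 (c * 1)) :=
          tendsto_const_nhds.mul tendsto_id
        rw [mul_one] at this
        exact this.mono_left nhdsWithin_le_nhds
      exact (eventually_mem_nhdsWithin.and (h1.eventually_lt_const hb)).exists
    filter_upwards [key l hl1] with r hr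
    exact hr.2.trans_lt hl2

/-- The leading coefficient `φ'(0) ^ n` of `f = φ ^ n` at `0`, divided by its modulus. -/
noncomputable def direction (φ : ℂ → ℂ) (n : ℕ) : ℂ :=
  dslope φ 0 0 ^ n / ((‖dslope φ 0 0‖ ^ n : ℝ) : ℂ)

theorem norm_direction (h : LocalRoot f n φ ψ) : ‖direction φ n‖ = 1 := by
  have : 0 < ‖dslope φ 0 0‖ ^ n := pow_pos (norm_pos_iff.2 h.dslope_ne_zero) n
  rw [direction, norm_div, norm_pow, Complex.norm_real, Real.norm_of_nonneg this.le,
    div_self this.ne']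

theorem tendsto_rescaling (h : LocalRoot f n φ ψ) (hn : n ≠ 0) (x : ℂ) :
    Tendsto (fun p : ℝ × ℂ => rescaling f 0 p.1 p.2) (𝓝[>] 0 ×ˢ 𝓝 x)
      (𝓝 (direction φ n * x ^ n)) := by
  have hc0 : 0 < ‖dslope φ 0 0‖ ^ n := pow_pos (norm_pos_iff.2 h.dslope_ne_zero) n
  have hr : Tendsto (fun p : ℝ × ℂ => p.1) (𝓝[>] 0 ×ˢ 𝓝 x) (𝓝[>] 0) := tendsto_fst
  have hz : Tendsto (fun p : ℝ × ℂ => (p.1 : ℂ) * p.2) (𝓝[>] 0 ×ˢ 𝓝 x) (𝓝 0) := by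
    have h1 : Tendsto (fun p : ℝ × ℂ => (p.1 : ℂ)) (𝓝[>] 0 ×ˢ 𝓝 x) (𝓝 ((0 : ℝ) : ℂ)) :=
      (Complex.continuous_ofReal.tendsto 0).comp (hr.mono_right nhdsWithin_le_nhds)
    simpa using h1.mul (tendsto_snd (f := 𝓝[>] (0 : ℝ)) (g := 𝓝 x))
  have hu : Tendsto (fun p : ℝ × ℂ => dslope φ 0 (p.1 * p.2) ^ n) (𝓝[>] 0 ×ˢ 𝓝 x)
      (𝓝 (dslope φ 0 0 ^ n)) :=
    (h.analytic.dslope_zero.continuousAt.tendsto.comp hz).pow n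
  have hρ : Tendsto (fun p : ℝ × ℂ => ((meanRadius f 0 p.1 / p.1 ^ n : ℝ) : ℂ)) (𝓝[>] 0 ×ˢ 𝓝 x)
      (𝓝 ((‖dslope φ 0 0‖ ^ n : ℝ) : ℂ)) :=
    (Complex.continuous_ofReal.tendsto _).comp ((h.tendsto_meanRadius hn).comp hr)
  have hlim := (hu.div hρ (by exact_mod_cast hc0.ne')).mul
    ((tendsto_snd (f := 𝓝[>] (0 : ℝ)) (g := 𝓝 x)).pow n)
  refine hlim.congr' ?_
  filter_upwards [hr.eventually self_mem_nhdsWithin, hz.eventually h.pow_eq] with p h1 h2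
  have h3 : (p.1 : ℂ) ≠ 0 := by exact_mod_cast (ne_of_gt h1)
  rw [rescaling, h.apply_zero hn, sub_zero, zero_add, h2, eq_mul_dslope_zero h.map_zero (p.1 * p.2),
    mul_pow, mul_pow]
  push_cast
  simp only [Pi.div_apply]
  field_simp

/-- A holomorphic germ is simple: its infinitesimal space has a single element. -/
theorem infinitesimalSpace_eq (h : LocalRoot f n φ ψ) (hn : n ≠ 0) :
    infinitesimalSpace f 0 = {fun z => direction φ n * z ^ n} := by
  have hlim : ∀ r : ℕ → ℝ, (∀ k, 0 < r k) → Tendsto r atTop (𝓝 0) → ∀ x : ℂ,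
      Tendsto (fun p : ℕ × ℂ => rescaling f 0 (r p.1) p.2) (atTop ×ˢ 𝓝 x)
        (𝓝 (direction φ n * x ^ n)) := by
    intro r hr0 hr x
    have h1 : Tendsto r atTop (𝓝[>] 0) :=
      tendsto_nhdsWithin_iff.2 ⟨hr, Eventually.of_forall hr0⟩
    have h2 : Tendsto (fun p : ℕ × ℂ => (r p.1, p.2)) (atTop ×ˢ 𝓝 x) (𝓝[>] 0 ×ˢ 𝓝 x) :=
      (h1.comp tendsto_fst).prodMk tendsto_snd
    have h3 := (h.tendsto_rescaling hn x).comp h2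
    exact h3
  apply Set.eq_singleton_iff_unique_mem.2
  constructor
  · refine ⟨fun k => 1 / ((k : ℝ) + 1), fun k => Nat.one_div_pos_of_nat, ?_,
      tendsto_one_div_add_atTop_nhds_zero_nat, ?_⟩
    · intro i j hij
      exact Nat.one_div_lt_one_div hij
    · rw [tendstoLocallyUniformly_iff_forall_tendsto]
      intro x
      have h1 := hlim _ (fun k => Nat.one_div_pos_of_nat)
        tendsto_one_div_add_atTop_nhds_zero_nat x
      have h2 : Tendsto (fun p : ℕ × ℂ => direction φ n * p.2 ^ n) (atTop ×ˢ 𝓝 x)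
          (𝓝 (direction φ n * x ^ n)) := tendsto_const_nhds.mul (tendsto_snd.pow n)
      exact (h2.prodMk_nhds h1).mono_right (nhds_le_uniformity _)
  · rintro g ⟨r, hr0, -, hr, hg⟩
    funext x
    have h1 : Tendsto (fun k => rescaling f 0 (r k) x) atTop (𝓝 (direction φ n * x ^ n)) :=
      Tendsto.comp (g := fun p : ℕ × ℂ => rescaling f 0 (r p.1) p.2) (f := fun k => (k, x))
        (hlim r hr0 hr x) (tendsto_id.prodMk tendsto_const_nhds)
    have h2 : Tendsto (fun k => rescaling f 0 (r k) x) atTop (𝓝 (g x)) := by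
      have := tendstoLocallyUniformlyOn_univ.2 hg
      exact this.tendsto_at (Set.mem_univ x)
    exact tendsto_nhds_unique h2 h1

end LocalRoot

/-! ### Sectors bounded by real-analytic curves -/

/-- The point of `ℂ` with polar coordinates `(r, θ)`. -/
noncomputable def polarPoint (r θ : ℝ) : ℂ := r * Complex.exp (θ * Complex.I)

theorem norm_polarPoint (r θ : ℝ) : ‖polarPoint r θ‖ = |r| := by
  simp [polarPoint, Complex.norm_exp_ofReal_mul_I]

theorem tendsto_polarPoint (θ₀ : ℝ) :
    Tendsto (fun p : ℝ × ℝ => polarPoint p.1 p.2) (𝓝[>] 0 ×ˢ 𝓝 θ₀) (𝓝[≠] 0) := by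
  refine tendsto_nhdsWithin_iff.2 ⟨?_, ?_⟩
  · rw [tendsto_zero_iff_norm_tendsto_zero]
    simp only [norm_polarPoint]
    have : Tendsto (fun p : ℝ × ℝ => p.1) (𝓝[>] 0 ×ˢ 𝓝 θ₀) (𝓝 0) :=
      tendsto_fst.mono_right nhdsWithin_le_nhds
    simpa using this.abs
  · have h : ∀ᶠ p : ℝ × ℝ in 𝓝[>] 0 ×ˢ 𝓝 θ₀, 0 < p.1 :=
      tendsto_fst.eventually self_mem_nhdsWithin
    filter_upwards [h] with p hp
    simp [polarPoint, hp.ne']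

theorem contDiff_polarPoint : ContDiff ℝ ω (fun p : ℝ × ℝ => polarPoint p.1 p.2) := by
  have h1 : ContDiff ℝ ω (fun x : ℝ => (x : ℂ)) := Complex.ofRealCLM.contDiff
  unfold polarPoint
  exact (h1.comp contDiff_fst).mul
    (((h1.comp contDiff_snd).mul contDiff_const).cexp)

/-- A real-analytic germ has a constant sign on the right of `0`. -/
theorem AnalyticAt.eventually_sign_right {g : ℝ → ℝ} (hg : AnalyticAt ℝ g 0) :
    (∀ᶠ r in 𝓝[>] (0 : ℝ), g r = 0) ∨ (∀ᶠ r in 𝓝[>] (0 : ℝ), 0 < g r) ∨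
      ∀ᶠ r in 𝓝[>] (0 : ℝ), g r < 0 := by
  by_cases h : ∀ᶠ r in 𝓝 (0 : ℝ), g r = 0
  · exact Or.inl (h.filter_mono nhdsWithin_le_nhds)
  obtain ⟨n, u, hu, hu0, hgu⟩ := hg.exists_eventuallyEq_pow_smul_nonzero_iff.2 h
  right
  rcases hu0.lt_or_gt with h0 | h0
  · right
    filter_upwards [hgu.filter_mono nhdsWithin_le_nhds, self_mem_nhdsWithin,
      (hu.continuousAt.eventually_lt_const h0).filter_mono nhdsWithin_le_nhds] with r h1 h2 h3
    rw [h1, sub_zero, smul_eq_mul]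
    exact mul_neg_of_pos_of_neg (pow_pos h2 n) h3
  · left
    filter_upwards [hgu.filter_mono nhdsWithin_le_nhds, self_mem_nhdsWithin,
      (hu.continuousAt.eventually_const_lt h0).filter_mono nhdsWithin_le_nhds] with r h1 h2 h3
    rw [h1, sub_zero, smul_eq_mul]
    exact mul_pos (pow_pos h2 n) h3

theorem AnalyticAt.eventually_le_or_ge_right {a b : ℝ → ℝ} (ha : AnalyticAt ℝ a 0)
    (hb : AnalyticAt ℝ b 0) :
    (∀ᶠ r in 𝓝[>] (0 : ℝ), a r ≤ b r) ∨ ∀ᶠ r in 𝓝[>] (0 : ℝ), b r ≤ a r := by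
  rcases (ha.sub hb).eventually_sign_right with h | h | h
  · exact Or.inl (h.mono fun r hr => (sub_eq_zero.1 hr).le)
  · exact Or.inr (h.mono fun r hr => (sub_pos.1 hr).le)
  · exact Or.inl (h.mono fun r hr => (sub_neg.1 hr).le)

theorem AnalyticAt.exists_eventually_eq_max {a b : ℝ → ℝ} (ha : AnalyticAt ℝ a 0)
    (hb : AnalyticAt ℝ b 0) :
    ∃ m : ℝ → ℝ, AnalyticAt ℝ m 0 ∧ ∀ᶠ r in 𝓝[>] (0 : ℝ), m r = max (a r) (b r) := by
  rcases ha.eventually_le_or_ge_right hb with h | h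
  · exact ⟨b, hb, h.mono fun r hr => (max_eq_right hr).symm⟩
  · exact ⟨a, ha, h.mono fun r hr => (max_eq_left hr).symm⟩

theorem AnalyticAt.exists_eventually_eq_min {a b : ℝ → ℝ} (ha : AnalyticAt ℝ a 0)
    (hb : AnalyticAt ℝ b 0) :
    ∃ m : ℝ → ℝ, AnalyticAt ℝ m 0 ∧ ∀ᶠ r in 𝓝[>] (0 : ℝ), m r = min (a r) (b r) := by
  rcases ha.eventually_le_or_ge_right hb with h | h
  · exact ⟨a, ha, h.mono fun r hr => (min_eq_left hr).symm⟩
  · exact ⟨b, hb, h.mono fun r hr => (min_eq_right hr).symm⟩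

/-- Near the direction `θ₀` at `0`, the planar set `T` is a sector `a(r) < θ < b(r)` bounded by
curves that are real-analytic in `r` up to `r = 0`. The points of the two curves themselves may or
may not belong to `T`. -/
def IsAnalyticSector (T : Set ℂ) (θ₀ : ℝ) : Prop :=
  ∃ a b : ℝ → ℝ, AnalyticAt ℝ a 0 ∧ AnalyticAt ℝ b 0 ∧
    ∀ᶠ p : ℝ × ℝ in 𝓝[>] 0 ×ˢ 𝓝 θ₀,
      (a p.1 < p.2 → p.2 < b p.1 → polarPoint p.1 p.2 ∈ T) ∧
      (polarPoint p.1 p.2 ∈ T → a p.1 ≤ p.2 ∧ p.2 ≤ b p.1)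

namespace IsAnalyticSector

variable {T S : Set ℂ} {θ₀ : ℝ}

theorem of_eventually_mem (h : ∀ᶠ p : ℝ × ℝ in 𝓝[>] 0 ×ˢ 𝓝 θ₀, polarPoint p.1 p.2 ∈ T) :
    IsAnalyticSector T θ₀ := by
  refine ⟨fun _ => θ₀ - 1, fun _ => θ₀ + 1, analyticAt_const, analyticAt_const, ?_⟩
  have h2 : ∀ᶠ p : ℝ × ℝ in 𝓝[>] 0 ×ˢ 𝓝 θ₀, p.2 ∈ Set.Ioo (θ₀ - 1) (θ₀ + 1) :=
    tendsto_snd.eventually (Ioo_mem_nhds (by linarith) (by linarith))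
  filter_upwards [h, h2] with p hp hp2
  exact ⟨fun _ _ => hp, fun _ => ⟨hp2.1.le, hp2.2.le⟩⟩

theorem of_eventually_notMem (h : ∀ᶠ p : ℝ × ℝ in 𝓝[>] 0 ×ˢ 𝓝 θ₀, polarPoint p.1 p.2 ∉ T) :
    IsAnalyticSector T θ₀ := by
  refine ⟨fun _ => 1, fun _ => 0, analyticAt_const, analyticAt_const, ?_⟩
  filter_upwards [h] with p hp
  exact ⟨fun h1 h2 => by linarith, fun h => absurd h hp⟩

theorem inter (hT : IsAnalyticSector T θ₀) (hS : IsAnalyticSector S θ₀) :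
    IsAnalyticSector (T ∩ S) θ₀ := by
  obtain ⟨a, b, ha, hb, hab⟩ := hT
  obtain ⟨a', b', ha', hb', hab'⟩ := hS
  obtain ⟨m, hm, hm'⟩ := ha.exists_eventually_eq_max ha'
  obtain ⟨l, hl, hl'⟩ := hb.exists_eventually_eq_min hb'
  refine ⟨m, l, hm, hl, ?_⟩
  filter_upwards [hab, hab', tendsto_fst.eventually hm', tendsto_fst.eventually hl']
    with p h1 h2 h3 h4
  rw [h3, h4]
  refine ⟨fun h5 h6 => ?_, fun h5 => ?_⟩
  · rw [max_lt_iff] at h5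
    rw [lt_min_iff] at h6
    exact ⟨h1.1 h5.1 h6.1, h2.1 h5.2 h6.2⟩
  · obtain ⟨h6, h7⟩ := h1.2 h5.1
    obtain ⟨h8, h9⟩ := h2.2 h5.2
    exact ⟨max_le h6 h8, le_min h7 h9⟩

theorem iInter {ι : Type*} [Finite ι] {T : ι → Set ℂ} (h : ∀ i, IsAnalyticSector (T i) θ₀) :
    IsAnalyticSector (⋂ i, T i) θ₀ := by
  classical
  cases nonempty_fintype ι
  have key : ∀ s : Finset ι, IsAnalyticSector (⋂ i ∈ s, T i) θ₀ := by
    intro s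
    induction s using Finset.induction_on with
    | empty => exact of_eventually_mem (by simp)
    | insert i s _ ih =>
      rw [Finset.set_biInter_insert]
      exact (h i).inter ih
  simpa using key Finset.univ

end IsAnalyticSector

/-- The angular part of `Re F` after the power of `r` in front is removed has simple zeros; the
implicit function theorem turns each into a real-analytic curve. -/
theorem isAnalyticSector_of_re {F : ℂ → ℂ} (hF : AnalyticAt ℂ F 0) (h0 : F 0 = 0)
    (hne : ¬ ∀ᶠ z in 𝓝 (0 : ℂ), F z = 0) {T : Set ℂ}
    (h1 : ∀ᶠ z in 𝓝[≠] (0 : ℂ), 0 < (F z).re → z ∈ T)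
    (h2 : ∀ᶠ z in 𝓝[≠] (0 : ℂ), z ∈ T → 0 ≤ (F z).re) (θ₀ : ℝ) : IsAnalyticSector T θ₀ := by
  obtain ⟨m, u, hu, hu0, hFu⟩ := hF.exists_eventuallyEq_pow_smul_nonzero_iff.2 hne
  have hm : m ≠ 0 := by
    rintro rfl
    have := hFu.self_of_nhds
    simp only [pow_zero, one_smul] at this
    exact hu0 (this ▸ h0)
  set P : ℝ × ℝ → ℝ := fun p =>
    (Complex.exp (p.2 * Complex.I) ^ m * u (polarPoint p.1 p.2)).re with hP
  have hz0 : polarPoint 0 θ₀ = 0 := by simp [polarPoint]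
  have hPc : ContDiffAt ℝ ω P (0, θ₀) := by
    have hu' : ContDiffAt ℝ ω u (polarPoint 0 θ₀) := by
      rw [hz0]
      exact (hu.restrictScalars (𝕜 := ℝ)).contDiffAt
    have h3 : ContDiffAt ℝ ω (fun p : ℝ × ℝ => u (polarPoint p.1 p.2)) (0, θ₀) :=
      ContDiffAt.comp (0, θ₀) hu' contDiff_polarPoint.contDiffAt
    have h4 : ContDiff ℝ ω (fun x : ℝ => (x : ℂ)) := Complex.ofRealCLM.contDiff
    have h5 : ContDiff ℝ ω (fun p : ℝ × ℝ => Complex.exp (p.2 * Complex.I) ^ m) :=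
      (((h4.comp contDiff_snd).mul contDiff_const).cexp).pow m
    exact Complex.reCLM.contDiff.contDiffAt.comp _ (h5.contDiffAt.mul h3)
  have hsign : ∀ᶠ p : ℝ × ℝ in 𝓝[>] 0 ×ˢ 𝓝 θ₀,
      (0 < P p → polarPoint p.1 p.2 ∈ T) ∧ (polarPoint p.1 p.2 ∈ T → 0 ≤ P p) := by
    have hpos : ∀ᶠ p : ℝ × ℝ in 𝓝[>] 0 ×ˢ 𝓝 θ₀, 0 < p.1 :=
      tendsto_fst.eventually self_mem_nhdsWithin
    filter_upwards [hpos, (tendsto_polarPoint θ₀).eventually h1,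
      (tendsto_polarPoint θ₀).eventually h2,
      (tendsto_polarPoint θ₀).eventually (hFu.filter_mono nhdsWithin_le_nhds)] with p hp h1 h2 h3
    have h4 : (F (polarPoint p.1 p.2)).re = p.1 ^ m * P p := by
      rw [h3, sub_zero, smul_eq_mul, hP]
      conv_lhs => enter [1, 1, 1]; rw [polarPoint]
      rw [mul_pow, mul_assoc, ← Complex.ofReal_pow, Complex.re_ofReal_mul]
    rw [h4] at h1 h2
    exact ⟨fun h => h1 (mul_pos (pow_pos hp m) h), fun h => by
      have := h2 h
      exact nonneg_of_mul_nonneg_right this (pow_pos hp m)⟩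
  have hle : 𝓝[>] (0 : ℝ) ×ˢ 𝓝 θ₀ ≤ 𝓝 ((0 : ℝ), θ₀) := by
    rw [nhds_prod_eq]
    exact prod_mono nhdsWithin_le_nhds le_rfl
  rcases lt_trichotomy (P (0, θ₀)) 0 with hlt | heq | hgt
  · refine IsAnalyticSector.of_eventually_notMem ?_
    filter_upwards [hsign, (hPc.continuousAt.eventually_lt_const hlt).filter_mono hle] with p h3 h4
    exact fun h => absurd (h3.2 h) (not_le.2 h4)
  swap
  · refine IsAnalyticSector.of_eventually_mem ?_
    filter_upwards [hsign, (hPc.continuousAt.eventually_const_lt hgt).filter_mono hle] with p h3 h4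
    exact h3.1 h4
  -- At a zero of `P (0, ·)` the number `w` is purely imaginary and non-zero, so that the angular
  -- derivative `Re (i m w) = -m Im w` does not vanish.
  set w : ℂ := Complex.exp (θ₀ * Complex.I) ^ m * u 0 with hw
  have hwre : w.re = 0 := by
    have : P (0, θ₀) = w.re := by simp [hP, hz0, hw]
    rw [← this, heq]
  have hw0 : w ≠ 0 := mul_ne_zero (pow_ne_zero _ (Complex.exp_ne_zero _)) hu0
  have hwim : w.im ≠ 0 := fun h => hw0 (Complex.ext hwre h)
  set ℓ : ℝ := -(m * w.im) with hℓ
  have hℓ0 : ℓ ≠ 0 := neg_ne_zero.2 (mul_ne_zero (by exact_mod_cast hm) hwim)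
  have hst := hPc.hasStrictFDerivAt (by simp : (ω : WithTop ℕ∞) ≠ 0)
  have hpart : fderiv ℝ P (0, θ₀) (0, 1) = ℓ := by
    have hline : HasDerivAt (fun θ : ℝ => ((0 : ℝ), θ)) (0, 1) θ₀ :=
      (hasDerivAt_const θ₀ (0 : ℝ)).prodMk (hasDerivAt_id θ₀)
    have h3 : HasDerivAt (fun θ : ℝ => P (0, θ)) (fderiv ℝ P (0, θ₀) (0, 1)) θ₀ :=
      HasFDerivAt.comp_hasDerivAt (f := fun θ : ℝ => ((0 : ℝ), θ)) θ₀ hst.hasFDerivAt hline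
    have h4 : HasDerivAt (fun θ : ℝ => P (0, θ)) ℓ θ₀ := by
      have h5 : HasDerivAt (fun z : ℂ => Complex.exp (m * (z * Complex.I)) * u 0)
          (Complex.exp (m * (θ₀ * Complex.I)) * (m * (1 * Complex.I)) * u 0) (θ₀ : ℂ) :=
        ((((hasDerivAt_id (θ₀ : ℂ)).mul_const Complex.I).const_mul (m : ℂ)).cexp).mul_const (u 0)
      have h6 := h5.real_of_complex
      have h7 : (Complex.exp (m * (θ₀ * Complex.I)) * (m * (1 * Complex.I)) * u 0).re = ℓ := by
        have : Complex.exp (m * (θ₀ * Complex.I)) * (m * (1 * Complex.I)) * u 0 =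
            (m : ℝ) * (w * Complex.I) := by
          rw [hw, Complex.exp_nat_mul]
          push_cast
          ring
        rw [this, Complex.re_ofReal_mul, Complex.mul_I_re, hℓ]
        ring
      rw [h7] at h6
      refine h6.congr_of_eventuallyEq (Eventually.of_forall fun θ => ?_)
      simp [hP, polarPoint, Complex.exp_nat_mul]
    exact h3.unique h4
  have hinv : (fderiv ℝ P (0, θ₀) ∘L .inr ℝ ℝ ℝ).IsInvertible := by
    refine ⟨ContinuousLinearEquiv.unitsEquivAut ℝ (Units.mk0 ℓ hℓ0), ?_⟩
    ext
    simp [hpart]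
  set a := hPc.implicitFunction (by simp) hinv with ha
  have haan : AnalyticAt ℝ a 0 := (hPc.contDiffAt_implicitFunction (by simp) hinv).analyticAt
  have ha0 : a 0 = θ₀ := hPc.implicitFunction_apply_self (by simp) hinv
  have haP : ∀ᶠ r in 𝓝 (0 : ℝ), P (r, a r) = 0 := by
    have := hPc.eventually_apply_implicitFunction (by simp) hinv
    rw [heq] at this
    exact this
  have hat : Tendsto a (𝓝 0) (𝓝 θ₀) := by
    have := haan.continuousAt.tendsto
    rwa [ha0] at this
  -- Strict differentiability at `(0, θ₀)`, applied to `p` and the point of the curve with the same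
  -- radius, shows that `P p` has the sign of `ℓ * (p.2 - a p.1)`.
  have hest : ∀ᶠ p : ℝ × ℝ in 𝓝[>] 0 ×ˢ 𝓝 θ₀,
      |P p - ℓ * (p.2 - a p.1)| ≤ |ℓ| / 2 * |p.2 - a p.1| := by
    have hb := hst.isLittleO.def (c := |ℓ| / 2) (by positivity)
    have ht1 : Tendsto (fun p : ℝ × ℝ => (p, (p.1, a p.1))) (𝓝[>] 0 ×ˢ 𝓝 θ₀)
        (𝓝 (((0 : ℝ), θ₀), ((0 : ℝ), θ₀))) := by
      rw [nhds_prod_eq]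
      refine Tendsto.prodMk hle ?_
      rw [nhds_prod_eq]
      have hf : Tendsto (fun p : ℝ × ℝ => p.1) (𝓝[>] 0 ×ˢ 𝓝 θ₀) (𝓝 0) :=
        tendsto_fst.mono_right nhdsWithin_le_nhds
      exact hf.prodMk (hat.comp hf)
    have hf : Tendsto (fun p : ℝ × ℝ => p.1) (𝓝[>] 0 ×ˢ 𝓝 θ₀) (𝓝 0) :=
      tendsto_fst.mono_right nhdsWithin_le_nhds
    filter_upwards [ht1.eventually hb, hf.eventually haP] with p h3 h4
    simp only [h4] at h3
    have h5 : p - (p.1, a p.1) = (p.2 - a p.1) • ((0 : ℝ), (1 : ℝ)) := by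
      ext <;> simp
    rw [h5, map_smul, hpart, norm_smul, sub_zero, smul_eq_mul, mul_comm (p.2 - a p.1)] at h3
    simpa [Prod.norm_def] using h3
  rcases hℓ0.lt_or_gt with hneg | hpos
  · refine ⟨fun _ => θ₀ - 1, a, analyticAt_const, haan, ?_⟩
    have h3 : ∀ᶠ p : ℝ × ℝ in 𝓝[>] 0 ×ˢ 𝓝 θ₀, θ₀ - 1 < p.2 :=
      tendsto_snd.eventually (Ioi_mem_nhds (by linarith))
    filter_upwards [hsign, hest, h3] with p h4 h5 h6
    rw [abs_of_neg hneg] at h5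
    refine ⟨fun _ h7 => h4.1 ?_, fun h7 => ⟨h6.le, ?_⟩⟩
    · rw [abs_of_neg (sub_neg.2 h7)] at h5
      have := neg_le_of_abs_le h5
      nlinarith [mul_pos_of_neg_of_neg hneg (sub_neg.2 h7)]
    · by_contra! h8
      have h9 := h4.2 h7
      rw [abs_of_pos (sub_pos.2 h8)] at h5
      have := le_of_abs_le h5
      nlinarith [mul_neg_of_neg_of_pos hneg (sub_pos.2 h8)]
  · refine ⟨a, fun _ => θ₀ + 1, haan, analyticAt_const, ?_⟩
    have h3 : ∀ᶠ p : ℝ × ℝ in 𝓝[>] 0 ×ˢ 𝓝 θ₀, p.2 < θ₀ + 1 :=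
      tendsto_snd.eventually (Iio_mem_nhds (by linarith))
    filter_upwards [hsign, hest, h3] with p h4 h5 h6
    rw [abs_of_pos hpos] at h5
    refine ⟨fun h7 _ => h4.1 ?_, fun h7 => ⟨?_, h6.le⟩⟩
    · rw [abs_of_pos (sub_pos.2 h7)] at h5
      have := neg_le_of_abs_le h5
      nlinarith [mul_pos hpos (sub_pos.2 h7)]
    · by_contra! h8
      have h9 := h4.2 h7
      rw [abs_of_neg (sub_neg.2 h8)] at h5
      have := le_of_abs_le h5
      nlinarith [mul_neg_of_pos_of_neg hpos (sub_neg.2 h8)]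

/-- If `F` vanishes identically, the set is empty near `0`. -/
theorem isAnalyticSector_of_re_pos {F : ℂ → ℂ} (hF : AnalyticAt ℂ F 0) (h0 : F 0 = 0) {T : Set ℂ}
    (hT : ∀ᶠ z in 𝓝[≠] (0 : ℂ), z ∈ T ↔ 0 < (F z).re) (θ₀ : ℝ) : IsAnalyticSector T θ₀ := by
  by_cases hne : ∀ᶠ z in 𝓝 (0 : ℂ), F z = 0
  · refine IsAnalyticSector.of_eventually_notMem ?_
    refine (tendsto_polarPoint θ₀).eventually (p := fun z => z ∉ T) ?_
    filter_upwards [hT, hne.filter_mono nhdsWithin_le_nhds] with z h1 h2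
    simp [h1, h2]
  · exact isAnalyticSector_of_re hF h0 hne (hT.mono fun z hz => hz.2)
      (hT.mono fun z hz h => (hz.1 h).le) θ₀

/-- If `F` vanishes identically, the set contains a neighbourhood of `0`. -/
theorem isAnalyticSector_of_re_nonneg {F : ℂ → ℂ} (hF : AnalyticAt ℂ F 0) (h0 : F 0 = 0)
    {T : Set ℂ} (hT : ∀ᶠ z in 𝓝[≠] (0 : ℂ), z ∈ T ↔ 0 ≤ (F z).re) (θ₀ : ℝ) :
    IsAnalyticSector T θ₀ := by
  by_cases hne : ∀ᶠ z in 𝓝 (0 : ℂ), F z = 0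
  · refine IsAnalyticSector.of_eventually_mem ?_
    refine (tendsto_polarPoint θ₀).eventually (p := fun z => z ∈ T) ?_
    filter_upwards [hT, hne.filter_mono nhdsWithin_le_nhds] with z h1 h2
    simp [h1, h2]
  · exact isAnalyticSector_of_re hF h0 hne (hT.mono fun z hz h => hz.2 h.le)
      (hT.mono fun z hz => hz.1) θ₀

/-! ### Angular integrals over analytic sectors -/

/-- The Taylor series of a real-analytic germ converges at complex points as well. -/
theorem AnalyticAt.exists_complexification {g : ℝ → ℝ} (hg : AnalyticAt ℝ g 0) :
    ∃ G : ℂ → ℂ, AnalyticAt ℂ G 0 ∧ ∀ᶠ r : ℝ in 𝓝 0, G r = g r := by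
  obtain ⟨p, hp⟩ := hg
  have hsum := hasFPowerSeriesAt_iff.1 hp
  set q : FormalMultilinearSeries ℂ ℂ ℂ :=
    FormalMultilinearSeries.ofScalars ℂ (fun n => (p.coeff n : ℂ)) with hq
  have hrad : 0 < q.radius := by
    obtain ⟨ρ, hρ0, hρ⟩ := ENNReal.lt_iff_exists_nnreal_btwn.1 hp.radius_pos
    obtain ⟨C, -, hC⟩ := p.norm_mul_pow_le_of_lt_radius hρ
    refine hρ0.trans_le (q.le_radius_of_bound C fun n => ?_)
    rw [hq, FormalMultilinearSeries.ofScalars_norm, Complex.norm_real,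
      ← FormalMultilinearSeries.norm_apply_eq_norm_coef]
    exact hC n
  have hqs := q.hasFPowerSeriesOnBall hrad
  refine ⟨q.sum, hqs.analyticAt, ?_⟩
  have h1 := hasFPowerSeriesAt_iff.1 hqs.hasFPowerSeriesAt
  have h2 : Tendsto (fun r : ℝ => (r : ℂ)) (𝓝 0) (𝓝 0) := by
    simpa using Complex.continuous_ofReal.tendsto 0
  filter_upwards [h2.eventually h1, hsum] with r h3 h4
  have h5 := Complex.hasSum_ofReal.2 h4
  rw [zero_add] at h3 h5
  have h6 : (fun n => (r : ℂ) ^ n • q.coeff n) = fun n => ((r ^ n • p.coeff n : ℝ) : ℂ) := by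
    funext n
    rw [hq, FormalMultilinearSeries.coeff_ofScalars]
    simp
  rw [h6] at h3
  exact h3.unique h5

/-- A parametric integral of a holomorphic function of two variables is holomorphic. -/
theorem analyticAt_intervalIntegral {K : ℂ × ℂ → ℂ}
    (hK : ∀ s ∈ Set.Icc (0 : ℝ) 1, AnalyticAt ℂ K (0, (s : ℂ))) :
    AnalyticAt ℂ (fun z => ∫ s in (0 : ℝ)..1, K (z, s)) 0 := by
  have hcompact : IsCompact ((fun s : ℝ => (s : ℂ)) '' Set.Icc 0 1) :=
    isCompact_Icc.image Complex.continuous_ofReal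
  obtain ⟨u, v, huo, -, hsu, htv, huv⟩ := generalized_tube_lemma
    (isCompact_singleton (x := (0 : ℂ))) hcompact (isOpen_analyticAt ℂ K) (by
      rintro ⟨z, w⟩ ⟨hz, s, hs, rfl⟩
      rw [Set.mem_singleton_iff] at hz
      subst hz
      exact hK s hs)
  have hmem : ∀ z ∈ u, ∀ s ∈ Set.Icc (0 : ℝ) 1, AnalyticAt ℂ K (z, (s : ℂ)) :=
    fun z hz s hs => huv ⟨hz, htv ⟨s, hs, rfl⟩⟩
  rw [Complex.analyticAt_iff_eventually_differentiableAt]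
  filter_upwards [huo.mem_nhds (hsu rfl)] with z₀ hz₀
  obtain ⟨R, hR, hRu⟩ := Metric.isOpen_iff.1 huo z₀ hz₀
  have hsub : Metric.closedBall z₀ (R / 2) ⊆ u :=
    (Metric.closedBall_subset_ball (by linarith)).trans hRu
  set K' : ℂ → ℝ → ℂ := fun z s => fderiv ℂ K (z, (s : ℂ)) (1, 0) with hK'
  have hcont : ContinuousOn (fun p : ℂ × ℝ => K' p.1 p.2)
      (Metric.closedBall z₀ (R / 2) ×ˢ Set.Icc (0 : ℝ) 1) := by
    intro p hp
    have h1 := (hmem p.1 (hsub hp.1) p.2 hp.2).fderiv.continuousAt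
    have h2 : ContinuousAt (fun p : ℂ × ℝ => (p.1, (p.2 : ℂ))) p := by fun_prop
    have h3 : ContinuousAt (fun p : ℂ × ℝ => fderiv ℂ K (p.1, (p.2 : ℂ))) p :=
      ContinuousAt.comp (f := fun p : ℂ × ℝ => (p.1, (p.2 : ℂ))) h1 h2
    exact (h3.clm_apply continuousAt_const).continuousWithinAt
  obtain ⟨C, hC⟩ :=
    ((isCompact_closedBall z₀ (R / 2)).prod isCompact_Icc).exists_bound_of_continuousOn hcont
  have hKc : ∀ z ∈ u, ContinuousOn (fun s : ℝ => K (z, (s : ℂ))) (Set.Icc 0 1) := by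
    intro z hz s hs
    have h1 := (hmem z hz s hs).continuousAt
    have h2 : ContinuousAt (fun s : ℝ => (z, (s : ℂ))) s := by fun_prop
    exact (ContinuousAt.comp (f := fun s : ℝ => (z, (s : ℂ))) h1 h2).continuousWithinAt
  have huIoc : Set.uIoc (0 : ℝ) 1 = Set.Ioc 0 1 := Set.uIoc_of_le zero_le_one
  have hint : ∀ z ∈ u, IntervalIntegrable (fun s : ℝ => K (z, (s : ℂ))) volume 0 1 :=
    fun z hz => (hKc z hz).intervalIntegrable_of_Icc zero_le_one
  have hz₀' : z₀ ∈ Metric.closedBall z₀ (R / 2) := Metric.mem_closedBall_self (by linarith)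
  have hK'c : ContinuousOn (K' z₀) (Set.Icc 0 1) :=
    hcont.comp (f := fun s : ℝ => (z₀, s)) (by fun_prop) fun s hs => ⟨hz₀', hs⟩
  refine (intervalIntegral.hasDerivAt_integral_of_dominated_loc_of_deriv_le
    (F := fun z s => K (z, (s : ℂ))) (F' := K') (bound := fun _ => C)
    (Metric.closedBall_mem_nhds z₀ (by linarith : 0 < R / 2)) ?_ (hint z₀ hz₀) ?_ ?_ ?_
    ?_).2.differentiableAt
  · filter_upwards [huo.mem_nhds hz₀] with z hz
    exact (hint z hz).aestronglyMeasurable_restrict_uIoc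
  · exact (hK'c.intervalIntegrable_of_Icc zero_le_one).aestronglyMeasurable_restrict_uIoc
  · refine Eventually.of_forall fun s hs z hz => ?_
    rw [huIoc] at hs
    exact hC (z, s) ⟨hz, ⟨hs.1.le, hs.2⟩⟩
  · exact intervalIntegrable_const
  · refine Eventually.of_forall fun s hs z hz => ?_
    rw [huIoc] at hs
    have h1 := (hmem z (hsub hz) s ⟨hs.1.le, hs.2⟩).differentiableAt.hasFDerivAt
    have hline : HasDerivAt (fun z : ℂ => (z, (s : ℂ))) (1, 0) z :=
      (hasDerivAt_id z).prodMk (hasDerivAt_const z _)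
    exact HasFDerivAt.comp_hasDerivAt (f := fun z : ℂ => (z, (s : ℂ))) z h1 hline

/-- The germ whose Taylor coefficients are the conjugates of those of `k`. -/
theorem AnalyticAt.conj_conj_zero {k : ℂ → ℂ} (hk : AnalyticAt ℂ k 0) :
    AnalyticAt ℂ (fun z => (starRingEnd ℂ) (k ((starRingEnd ℂ) z))) 0 := by
  rw [Complex.analyticAt_iff_eventually_differentiableAt] at hk ⊢
  have h : Tendsto (starRingEnd ℂ) (𝓝 0) (𝓝 0) := by
    simpa using Complex.continuous_conj.tendsto 0
  filter_upwards [h.eventually hk] with z hz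
  have := hz.conj_conj
  rw [Complex.conj_conj] at this
  exact this

/-- Between real-analytic curves the angular integral of `‖k‖ ^ 2` is, for small radii, the
restriction of a holomorphic germ: `‖k‖ ^ 2 = k * conj k` is holomorphic in the complexified
polar coordinates. -/
theorem exists_analyticAt_eq_integral_between {k : ℂ → ℂ} (hk : AnalyticAt ℂ k 0) {a b : ℝ → ℝ}
    (ha : AnalyticAt ℝ a 0) (hb : AnalyticAt ℝ b 0) :
    ∃ G : ℂ → ℂ, AnalyticAt ℂ G 0 ∧
      ∀ᶠ r : ℝ in 𝓝 0, G r = ((∫ θ in a r..b r, ‖k (polarPoint r θ)‖ ^ 2 : ℝ) : ℂ) := by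
  obtain ⟨A, hA, hAa⟩ := ha.exists_complexification
  obtain ⟨B, hB, hBb⟩ := hb.exists_complexification
  set Q : ℂ → ℂ → ℂ := fun z t => k (z * Complex.exp (t * Complex.I)) *
    (starRingEnd ℂ) (k ((starRingEnd ℂ) (z * Complex.exp (-t * Complex.I)))) with hQ
  set S : ℂ × ℂ → ℂ := fun p => A p.1 + (B p.1 - A p.1) * p.2 with hS
  have hSan : ∀ s : ℂ, AnalyticAt ℂ S (0, s) := fun s => by
    have h1 : AnalyticAt ℂ (fun p : ℂ × ℂ => A p.1) (0, s) :=
      AnalyticAt.comp (f := fun p : ℂ × ℂ => p.1) (x := ((0 : ℂ), s)) hA analyticAt_fst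
    have h2 : AnalyticAt ℂ (fun p : ℂ × ℂ => B p.1) (0, s) :=
      AnalyticAt.comp (f := fun p : ℂ × ℂ => p.1) (x := ((0 : ℂ), s)) hB analyticAt_fst
    exact h1.add ((h2.sub h1).mul analyticAt_snd)
  have hKan : ∀ s : ℂ, AnalyticAt ℂ (fun p : ℂ × ℂ => Q p.1 (S p)) (0, s) := fun s => by
    have h1 : AnalyticAt ℂ (fun p : ℂ × ℂ => p.1 * Complex.exp (S p * Complex.I)) (0, s) :=
      analyticAt_fst.mul ((hSan s).mul analyticAt_const).cexp
    have h2 : AnalyticAt ℂ (fun p : ℂ × ℂ => p.1 * Complex.exp (-S p * Complex.I)) (0, s) :=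
      analyticAt_fst.mul ((hSan s).neg.mul analyticAt_const).cexp
    refine AnalyticAt.mul ?_ ?_
    · refine AnalyticAt.fun_comp (g := k) ?_ h1
      simpa using hk
    · refine AnalyticAt.fun_comp (g := fun z => (starRingEnd ℂ) (k ((starRingEnd ℂ) z))) ?_ h2
      simpa using hk.conj_conj_zero
  refine ⟨fun z => (B z - A z) * ∫ s in (0 : ℝ)..1, Q z (S (z, s)),
    (hB.sub hA).mul (analyticAt_intervalIntegral fun s _ => hKan s), ?_⟩
  filter_upwards [hAa, hBb] with r h1 h2
  have hQr : ∀ θ : ℝ, Q r θ = ((‖k (polarPoint r θ)‖ ^ 2 : ℝ) : ℂ) := by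
    intro θ
    have h3 : (starRingEnd ℂ) (r * Complex.exp (-θ * Complex.I)) = polarPoint r θ := by
      rw [map_mul, ← Complex.exp_conj, polarPoint]
      simp
    rw [hQ]
    simp only
    rw [h3, ← polarPoint, Complex.mul_conj, Complex.normSq_eq_norm_sq]
  have h4 := intervalIntegral.smul_integral_comp_add_mul (a := 0) (b := 1)
    (fun θ : ℝ => Q r θ) (b r - a r) (a r)
  simp only [mul_zero, add_zero, mul_one, add_sub_cancel] at h4
  rw [← intervalIntegral.integral_ofReal]
  simp only [← hQr]
  rw [← h4, h1, h2, Complex.real_smul]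
  push_cast
  simp only [hS, h1, h2]

/-- The function `‖k‖ ^ 2` on `T`, extended by `0`, in polar coordinates. With `f' z = z ^ m * k z`
it is the density of the area of the image of `T`, up to a power of `r`. -/
noncomputable def sectorDensity (T : Set ℂ) (k : ℂ → ℂ) (r θ : ℝ) : ℝ :=
  T.indicator (fun z => ‖k z‖ ^ 2) (polarPoint r θ)

/-- For small `r > 0` the angular integral of the density over `[α, β]` exists and is given by a
holomorphic germ in `r`. -/
def HasAnalyticAngularIntegral (T : Set ℂ) (k : ℂ → ℂ) (α β : ℝ) : Prop :=
  ∃ G : ℂ → ℂ, AnalyticAt ℂ G 0 ∧ ∀ᶠ r : ℝ in 𝓝[>] 0,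
    IntervalIntegrable (sectorDensity T k r) volume α β ∧
      G r = ((∫ θ in α..β, sectorDensity T k r θ : ℝ) : ℂ)

theorem HasAnalyticAngularIntegral.trans {T : Set ℂ} {k : ℂ → ℂ} {α β γ : ℝ}
    (h1 : HasAnalyticAngularIntegral T k α β) (h2 : HasAnalyticAngularIntegral T k β γ) :
    HasAnalyticAngularIntegral T k α γ := by
  obtain ⟨G, hG, h1⟩ := h1
  obtain ⟨G', hG', h2⟩ := h2
  refine ⟨fun z => G z + G' z, hG.add hG', ?_⟩
  filter_upwards [h1, h2] with r h3 h4
  refine ⟨h3.1.trans h4.1, ?_⟩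
  rw [h3.2, h4.2, ← Complex.ofReal_add, intervalIntegral.integral_add_adjacent_intervals h3.1 h4.1]

theorem IsAnalyticSector.exists_hasAnalyticAngularIntegral {T : Set ℂ} {θ₀ : ℝ}
    (hT : IsAnalyticSector T θ₀) {k : ℂ → ℂ} (hk : AnalyticAt ℂ k 0) :
    ∃ δ > 0, ∀ α β, α ≤ β → Set.Icc α β ⊆ Metric.ball θ₀ δ →
      HasAnalyticAngularIntegral T k α β := by
  obtain ⟨a, b, ha, hb, hab⟩ := hT
  obtain ⟨p, hp, q, hq, hpq⟩ := eventually_prod_iff.1 hab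
  obtain ⟨δ, hδ, hδq⟩ := Metric.eventually_nhds_iff_ball.1 hq
  refine ⟨δ, hδ, fun α β hαβ hsub => ?_⟩
  obtain ⟨a', ha', haa'⟩ := ha.exists_eventually_eq_max (analyticAt_const (v := α))
  obtain ⟨b', hb', hbb'⟩ := hb.exists_eventually_eq_min (analyticAt_const (v := β))
  obtain ⟨ε, hε, hkε⟩ := Metric.eventually_nhds_iff_ball.1 hk.eventually_analyticAt
  have hcont : ∀ᶠ r : ℝ in 𝓝[>] 0, Continuous fun θ => ‖k (polarPoint r θ)‖ ^ 2 := by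
    filter_upwards [Ioo_mem_nhdsGT hε] with r hr
    refine continuous_iff_continuousAt.2 fun θ => ?_
    have h1 : ContinuousAt k (polarPoint r θ) := by
      refine (hkε _ ?_).continuousAt
      rw [mem_ball_zero_iff, norm_polarPoint, abs_of_pos hr.1]
      exact hr.2
    have h2 : ContinuousAt (fun θ => polarPoint r θ) θ := by
      unfold polarPoint
      fun_prop
    exact ((ContinuousAt.comp (f := fun θ => polarPoint r θ) h1 h2).norm).pow 2
  -- The two end points of the arc, where membership in `T` is not known, are a null set.
  have hae : ∀ᶠ r : ℝ in 𝓝[>] 0, ∀ᵐ θ ∂(volume.restrict (Set.Ioc α β)),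
      sectorDensity T k r θ =
        (Set.Ioc (a' r) (b' r)).indicator (fun θ => ‖k (polarPoint r θ)‖ ^ 2) θ := by
    filter_upwards [hp, haa', hbb'] with r h1 h2 h3
    have h4 : ∀ᵐ θ ∂(volume : Measure ℝ), θ ≠ a' r ∧ θ ≠ b' r :=
      (Measure.ae_ne volume _).and (Measure.ae_ne volume _)
    filter_upwards [ae_restrict_mem measurableSet_Ioc, ae_restrict_of_ae h4] with θ h5 h6
    have h7 := hpq h1 (hδq θ (hsub ⟨h5.1.le, h5.2⟩))
    unfold sectorDensity
    by_cases h8 : θ ∈ Set.Ioc (a' r) (b' r)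
    · have h9 := lt_of_le_of_ne h8.2 h6.2
      have h10 := h8.1
      rw [h2, max_lt_iff] at h10
      rw [h3, lt_min_iff] at h9
      rw [Set.indicator_of_mem h8, Set.indicator_of_mem (h7.1 h10.1 h9.1)]
    · rw [Set.indicator_of_notMem h8, Set.indicator_of_notMem]
      intro h9
      obtain ⟨h10, h11⟩ := h7.2 h9
      refine h8 ⟨lt_of_le_of_ne ?_ (Ne.symm h6.1), ?_⟩
      · rw [h2]
        exact max_le h10 h5.1.le
      · rw [h3]
        exact le_min h11 h5.2
  have hsubI : ∀ᶠ r : ℝ in 𝓝[>] 0, Set.Ioc (a' r) (b' r) ⊆ Set.Ioc α β := by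
    filter_upwards [haa', hbb'] with r h1 h2
    rw [h1, h2]
    exact Set.Ioc_subset_Ioc (le_max_right _ _) (min_le_right _ _)
  have hval : ∀ᶠ r : ℝ in 𝓝[>] 0, IntervalIntegrable (sectorDensity T k r) volume α β ∧
      ∫ θ in α..β, sectorDensity T k r θ =
        ∫ θ in Set.Ioc (a' r) (b' r), ‖k (polarPoint r θ)‖ ^ 2 := by
    filter_upwards [hae, hsubI, hcont] with r h1 h2 h3
    have h4 : IntegrableOn (fun θ => ‖k (polarPoint r θ)‖ ^ 2) (Set.Ioc α β) :=
      (intervalIntegrable_iff_integrableOn_Ioc_of_le hαβ).1 (h3.intervalIntegrable α β)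
    refine ⟨(intervalIntegrable_iff_integrableOn_Ioc_of_le hαβ).2 ?_, ?_⟩
    · exact (Integrable.indicator h4 measurableSet_Ioc).congr (h1.mono fun _ h => h.symm)
    · rw [intervalIntegral.integral_of_le hαβ, integral_congr_ae h1,
        setIntegral_indicator measurableSet_Ioc, Set.inter_eq_self_of_subset_right h2]
  rcases ha'.eventually_le_or_ge_right hb' with hle | hge
  · obtain ⟨G, hG, hGr⟩ := exists_analyticAt_eq_integral_between hk ha' hb'
    refine ⟨G, hG, ?_⟩
    filter_upwards [hval, hle, hGr.filter_mono nhdsWithin_le_nhds] with r h1 h2 h3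
    refine ⟨h1.1, ?_⟩
    rw [h3, h1.2, intervalIntegral.integral_of_le h2]
  · refine ⟨fun _ => 0, analyticAt_const, ?_⟩
    filter_upwards [hval, hge] with r h1 h2
    refine ⟨h1.1, ?_⟩
    rw [h1.2, Set.Ioc_eq_empty (not_lt.2 h2)]
    simp

/-- The local statement over small angular intervals propagates to every interval by
compactness. -/
theorem hasAnalyticAngularIntegral {T : Set ℂ} (hT : ∀ θ₀, IsAnalyticSector T θ₀) {k : ℂ → ℂ}
    (hk : AnalyticAt ℂ k 0) {α β : ℝ} (hαβ : α ≤ β) : HasAnalyticAngularIntegral T k α β := by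
  choose δ hδ h using fun θ₀ => (hT θ₀).exists_hasAnalyticAngularIntegral hk
  obtain ⟨t, ht0, htm, ⟨m, hm⟩, hc⟩ := exists_monotone_Icc_subset_open_cover_Icc hαβ
    (c := fun θ₀ : ℝ => (Subtype.val : Set.Icc α β → ℝ) ⁻¹' Metric.ball θ₀ (δ θ₀))
    (fun θ₀ => Metric.isOpen_ball.preimage continuous_subtype_val)
    (fun θ _ => Set.mem_iUnion.2 ⟨θ, Metric.mem_ball_self (hδ _)⟩)
  have key : ∀ n, HasAnalyticAngularIntegral T k α (t n) := by
    intro n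
    induction n with
    | zero =>
      rw [ht0]
      exact ⟨fun _ => 0, analyticAt_const, Eventually.of_forall fun r => by simp⟩
    | succ n ih =>
      obtain ⟨θ₀, hθ⟩ := hc n
      refine ih.trans (h θ₀ _ _ (htm n.le_succ) fun θ hθ' => ?_)
      have hmem : θ ∈ Set.Icc α β :=
        ⟨(t n).2.1.trans hθ'.1, hθ'.2.trans (t (n + 1)).2.2⟩
      exact hθ (show (⟨θ, hmem⟩ : Set.Icc α β) ∈ Set.Icc (t n) (t (n + 1)) from hθ')
  have := key m
  rwa [hm m le_rfl] at this

/-! ### Preimages of minimal modulus -/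

/-- The open sector `|arg w| < π / d`, `d ≥ 2`, written as the intersection of two half-planes. -/
def rootSector (d : ℕ) : Set ℂ :=
  {w | 0 < (Complex.exp ((Real.pi / 2 - Real.pi / d : ℝ) * Complex.I) * w).re} ∩
    {w | 0 < (Complex.exp (-(Real.pi / 2 - Real.pi / d : ℝ) * Complex.I) * w).re}

theorem re_exp_mul_I_mul (t : ℝ) (w : ℂ) :
    (Complex.exp (t * Complex.I) * w).re = ‖w‖ * Real.cos (w.arg + t) := by
  nth_rewrite 1 [← Complex.norm_mul_exp_arg_mul_I w]
  have : Complex.exp (t * Complex.I) * (‖w‖ * Complex.exp (w.arg * Complex.I)) =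
      (‖w‖ : ℂ) * Complex.exp (((w.arg + t : ℝ) : ℂ) * Complex.I) := by
    rw [mul_left_comm, ← Complex.exp_add]
    push_cast
    ring_nf
  rw [this, Complex.re_ofReal_mul, Complex.exp_ofReal_mul_I_re]

theorem mem_rootSector_iff {d : ℕ} {w : ℂ} :
    w ∈ rootSector d ↔ 0 < ‖w‖ * Real.cos (w.arg + (Real.pi / 2 - Real.pi / d)) ∧
      0 < ‖w‖ * Real.cos (w.arg - (Real.pi / 2 - Real.pi / d)) := by
  have h := re_exp_mul_I_mul (-(Real.pi / 2 - Real.pi / d)) w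
  rw [← sub_eq_add_neg] at h
  rw [← re_exp_mul_I_mul, ← h]
  push_cast
  simp [rootSector]

theorem abs_arg_lt_of_mem_rootSector {d : ℕ} (hd : 2 ≤ d) {w : ℂ} (hw : w ∈ rootSector d) :
    |w.arg| < Real.pi / d := by
  rw [mem_rootSector_iff] at hw
  have h1 := pos_of_mul_pos_right hw.1 (norm_nonneg w)
  have h2 := pos_of_mul_pos_right hw.2 (norm_nonneg w)
  have h3 := Real.pi_pos
  have h4 : Real.pi / d ≤ Real.pi / 2 := by
    gcongr
    exact_mod_cast hd
  have h5 : 0 < Real.pi / d := by positivity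
  rw [abs_lt]
  constructor
  · by_contra! h
    rw [← Real.cos_neg] at h2
    exact absurd h2 (not_lt.2 (Real.cos_nonpos_of_pi_div_two_le_of_le (by linarith)
      (by linarith [Complex.neg_pi_lt_arg w])))
  · by_contra! h
    exact absurd h1 (not_lt.2 (Real.cos_nonpos_of_pi_div_two_le_of_le (by linarith)
      (by linarith [Complex.arg_le_pi w])))

theorem eq_of_pow_eq_of_mem_rootSector {d : ℕ} (hd : 2 ≤ d) {w w' : ℂ} (hw : w ∈ rootSector d)
    (hw' : w' ∈ rootSector d) (h : w ^ d = w' ^ d) : w = w' := by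
  have h1 := abs_lt.1 (abs_arg_lt_of_mem_rootSector hd hw)
  have h2 := abs_lt.1 (abs_arg_lt_of_mem_rootSector hd hw')
  rw [← Complex.pow_cpow_nat_inv (n := d) (by omega) h1.1 h1.2.le, h,
    Complex.pow_cpow_nat_inv (by omega) h2.1 h2.2.le]

theorem exists_mem_rootSector_pow_eq {d : ℕ} (hd : 2 ≤ d) {y : ℂ} (hy : y ∈ Complex.slitPlane) :
    ∃ w ∈ rootSector d, w ^ d = y := by
  have hy0 : y ≠ 0 := Complex.slitPlane_ne_zero hy
  have hd0 : (d : ℂ) ≠ 0 := by exact_mod_cast (by omega : d ≠ 0)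
  have h3 := Real.pi_pos
  have hd' : (2 : ℝ) ≤ d := by exact_mod_cast hd
  have h4 : Real.pi / d ≤ Real.pi / 2 := by gcongr
  have h5 : 0 < Real.pi / d := by positivity
  have harg : |y.arg / d| < Real.pi / d := by
    rw [abs_div, Nat.abs_cast]
    gcongr
    exact abs_lt.2 ⟨Complex.neg_pi_lt_arg y,
      lt_of_le_of_ne (Complex.arg_le_pi y) (Complex.mem_slitPlane_iff_arg.1 hy).1⟩
  rw [abs_lt] at harg
  have him : (Complex.log y / d).im = y.arg / d := by
    rw [Complex.div_natCast_im, Complex.log_im]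
  have hwarg : (Complex.exp (Complex.log y / d)).arg = y.arg / d := by
    rw [← Complex.log_im, Complex.log_exp (by rw [him]; linarith) (by rw [him]; linarith), him]
  refine ⟨Complex.exp (Complex.log y / d), ?_, ?_⟩
  · have hn : 0 < ‖Complex.exp (Complex.log y / d)‖ := norm_pos_iff.2 (Complex.exp_ne_zero _)
    rw [mem_rootSector_iff, hwarg]
    exact ⟨mul_pos hn (Real.cos_pos_of_mem_Ioo ⟨by linarith, by linarith⟩),
      mul_pos hn (Real.cos_pos_of_mem_Ioo ⟨by linarith, by linarith⟩)⟩
  · rw [← Complex.exp_nat_mul, mul_div_cancel₀ _ hd0, Complex.exp_log hy0]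

/-- A primitive `d`-th root of unity. -/
noncomputable def unitRoot (d : ℕ) : ℂ := Complex.exp (2 * Real.pi * Complex.I / d)

/-- The points `z` for which `φ z` lies in the `j`-th rotated copy of the root sector and which have
minimal modulus among the preimages `ψ (ζ ^ i * w)`, `w = ζ ^ (-j) * φ z`, of `f z = φ z ^ d`. Among
several preimages of minimal modulus the one of least index is selected: the inequality is strict
for `i < j`. Thus almost every value of `f` near `0` is taken exactly once on the union of the `d`
cells. -/
def minimalCell (φ ψ : ℂ → ℂ) {d : ℕ} (j : Fin d) : Set ℂ :=
  {z | (unitRoot d ^ (j : ℕ))⁻¹ * φ z ∈ rootSector d} ∩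
    ⋂ i : Fin d,
      ({z | i < j → ‖z‖ < ‖ψ (unitRoot d ^ (i : ℕ) * ((unitRoot d ^ (j : ℕ))⁻¹ * φ z))‖} ∩
        {z | ‖z‖ ≤ ‖ψ (unitRoot d ^ (i : ℕ) * ((unitRoot d ^ (j : ℕ))⁻¹ * φ z))‖})

theorem isPrimitiveRoot_unitRoot {d : ℕ} (hd : d ≠ 0) : IsPrimitiveRoot (unitRoot d) d :=
  Complex.isPrimitiveRoot_exp d hd

theorem norm_unitRoot_pow {d : ℕ} (hd : d ≠ 0) (i : ℕ) : ‖unitRoot d ^ i‖ = 1 := by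
  rw [norm_pow, (isPrimitiveRoot_unitRoot hd).norm'_eq_one hd, one_pow]

theorem unitRoot_pow_ne_zero {d : ℕ} (hd : d ≠ 0) (i : ℕ) : unitRoot d ^ i ≠ 0 := by
  rw [← norm_ne_zero_iff, norm_unitRoot_pow hd]
  exact one_ne_zero

/-- Disks on which the local normal form `f = φ ^ d` is valid. -/
structure IsRootDomain (f φ ψ : ℂ → ℂ) (d : ℕ) (δ δ' : ℝ) : Prop where
  analytic : ∀ z ∈ Metric.ball (0 : ℂ) δ, AnalyticAt ℂ f z
  continuousAt : ∀ z ∈ Metric.ball (0 : ℂ) δ, ContinuousAt φ z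
  continuousAt_inv : ∀ w ∈ Metric.ball (0 : ℂ) δ', ContinuousAt ψ w
  left_inv : ∀ z ∈ Metric.ball (0 : ℂ) δ, ψ (φ z) = z
  pow_eq : ∀ z ∈ Metric.ball (0 : ℂ) δ, f z = φ z ^ d
  norm_lt : ∀ z ∈ Metric.ball (0 : ℂ) δ, ‖φ z‖ < δ'
  right_inv : ∀ w ∈ Metric.ball (0 : ℂ) δ', φ (ψ w) = w

theorem LocalRoot.exists_isRootDomain {f φ ψ : ℂ → ℂ} {d : ℕ} (h : LocalRoot f d φ ψ)
    (hf : AnalyticAt ℂ f 0) : ∃ δ > 0, ∃ δ', IsRootDomain f φ ψ d δ δ' := by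
  obtain ⟨δ', hδ', h'⟩ := Metric.eventually_nhds_iff_ball.1
    (h.right_inv.and h.analytic_inv.eventually_analyticAt)
  have hφ := h.tendsto.eventually (Metric.ball_mem_nhds (0 : ℂ) hδ')
  obtain ⟨δ, hδ, hb⟩ := Metric.eventually_nhds_iff_ball.1
    (((h.left_inv.and h.pow_eq).and (hφ.and hf.eventually_analyticAt)).and
      h.analytic.eventually_analyticAt)
  exact ⟨δ, hδ, δ', fun z hz => (hb z hz).1.2.2, fun z hz => (hb z hz).2.continuousAt,
    fun w hw => (h' w hw).2.continuousAt, fun z hz => (hb z hz).1.1.1,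
    fun z hz => (hb z hz).1.1.2, fun z hz => by simpa using (hb z hz).1.2.1,
    fun w hw => (h' w hw).1⟩

namespace IsRootDomain

variable {f φ ψ : ℂ → ℂ} {d : ℕ} {δ δ' r : ℝ}

/-- A point `z` of a cell is described by the root `w` of `f z` in the sector: the preimages of
`f z` near `0` are the points `ψ (ζ ^ i * w)`, where `ζ` is the chosen primitive root of unity. -/
theorem exists_sector_of_mem_minimalCell (h : IsRootDomain f φ ψ d δ δ') (hd : 2 ≤ d)
    (hr : r ≤ δ) {j : Fin d} {z : ℂ} (hz : z ∈ Metric.ball 0 r ∩ minimalCell φ ψ j) :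
    ∃ w ∈ rootSector d, z = ψ (unitRoot d ^ (j : ℕ) * w) ∧ f z = w ^ d ∧
      ∀ i : Fin d, (i < j → ‖z‖ < ‖ψ (unitRoot d ^ (i : ℕ) * w)‖) ∧
        ‖z‖ ≤ ‖ψ (unitRoot d ^ (i : ℕ) * w)‖ := by
  have hd0 : d ≠ 0 := by omega
  have hzδ := Metric.ball_subset_ball hr hz.1
  have hne := unitRoot_pow_ne_zero hd0 (j : ℕ)
  have hmul : unitRoot d ^ (j : ℕ) * ((unitRoot d ^ (j : ℕ))⁻¹ * φ z) = φ z :=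
    mul_inv_cancel_left₀ hne _
  refine ⟨(unitRoot d ^ (j : ℕ))⁻¹ * φ z, hz.2.1, ?_, ?_, fun i => ?_⟩
  · rw [hmul, h.left_inv z hzδ]
  · rw [h.pow_eq z hzδ, mul_pow, inv_pow, ← pow_mul, mul_comm (j : ℕ) d, pow_mul,
      (isPrimitiveRoot_unitRoot hd0).pow_eq_one, one_pow, inv_one, one_mul]
  · exact Set.mem_iInter.1 hz.2.2 i

theorem injOn_minimalCell (h : IsRootDomain f φ ψ d δ δ') (hd : 2 ≤ d) (hr : r ≤ δ) (j : Fin d) :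
    Set.InjOn f (Metric.ball 0 r ∩ minimalCell φ ψ j) := by
  intro z hz z' hz' hzz
  obtain ⟨w, hw, h1, h2, -⟩ := h.exists_sector_of_mem_minimalCell hd hr hz
  obtain ⟨w', hw', h1', h2', -⟩ := h.exists_sector_of_mem_minimalCell hd hr hz'
  have : w = w' := eq_of_pow_eq_of_mem_rootSector hd hw hw' (by rw [← h2, ← h2', hzz])
  rw [h1, h1', this]

theorem disjoint_image_of_lt (h : IsRootDomain f φ ψ d δ δ') (hd : 2 ≤ d) (hr : r ≤ δ)
    {i j : Fin d} (hij : i < j) :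
    Disjoint (f '' (Metric.ball 0 r ∩ minimalCell φ ψ i))
      (f '' (Metric.ball 0 r ∩ minimalCell φ ψ j)) := by
  rw [Set.disjoint_left]
  rintro _ ⟨z, hz, rfl⟩ ⟨z', hz', hzz⟩
  obtain ⟨w, hw, h1, h2, h3⟩ := h.exists_sector_of_mem_minimalCell hd hr hz
  obtain ⟨w', hw', h1', h2', h3'⟩ := h.exists_sector_of_mem_minimalCell hd hr hz'
  have : w = w' := eq_of_pow_eq_of_mem_rootSector hd hw hw' (by rw [← h2, ← h2', hzz])
  subst this
  have h4 := (h3 j).2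
  have h5 := (h3' i).1 hij
  rw [← h1'] at h4
  rw [← h1] at h5
  exact absurd h5 (not_lt.2 h4)

theorem pairwise_disjoint_image (h : IsRootDomain f φ ψ d δ δ') (hd : 2 ≤ d) (hr : r ≤ δ) :
    Pairwise (Function.onFun Disjoint fun j : Fin d =>
      f '' (Metric.ball 0 r ∩ minimalCell φ ψ j)) := by
  intro i j hij
  rcases hij.lt_or_gt with hlt | hgt
  · exact h.disjoint_image_of_lt hd hr hlt
  · exact (h.disjoint_image_of_lt hd hr hgt).symm

/-- The slit is removed because values on it have no `d`-th root in the open sector. A preimage of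
minimal modulus of a value in `f '' B(0, r)` lies in `B(0, r)` as well. -/
theorem image_ball_inter_slitPlane_subset (h : IsRootDomain f φ ψ d δ δ') (hd : 2 ≤ d)
    (hr : r ≤ δ) :
    f '' Metric.ball 0 r ∩ Complex.slitPlane ⊆
      ⋃ j : Fin d, f '' (Metric.ball 0 r ∩ minimalCell φ ψ j) := by
  rintro _ ⟨⟨z, hz, rfl⟩, hslit⟩
  have hd0 : d ≠ 0 := by omega
  have : NeZero d := ⟨hd0⟩
  have hζ := isPrimitiveRoot_unitRoot hd0
  have hzδ := Metric.ball_subset_ball hr hz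
  obtain ⟨w, hw, hwd⟩ := exists_mem_rootSector_pow_eq hd hslit
  rw [h.pow_eq z hzδ] at hwd
  have hw0 : w ≠ 0 := by
    rintro rfl
    rw [zero_pow hd0] at hwd
    rw [h.pow_eq z hzδ, ← hwd] at hslit
    exact Complex.slitPlane_ne_zero hslit rfl
  have hwn : ‖w‖ = ‖φ z‖ := by
    have := congrArg norm hwd
    rw [norm_pow, norm_pow] at this
    exact (pow_left_inj₀ (norm_nonneg _) (norm_nonneg _) hd0).1 this
  obtain ⟨m, hm, hmz⟩ := hζ.eq_pow_of_pow_eq_one (ξ := φ z / w) (by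
    rw [div_pow, ← hwd, div_self (pow_ne_zero d hw0)])
  have hmz' : φ z = unitRoot d ^ m * w := by rw [hmz, div_mul_cancel₀ _ hw0]
  have hmem : ∀ i : ℕ, unitRoot d ^ i * w ∈ Metric.ball (0 : ℂ) δ' := fun i => by
    rw [mem_ball_zero_iff, norm_mul, norm_unitRoot_pow hd0, one_mul, hwn]
    exact h.norm_lt z hzδ
  have : Nonempty (Fin d) := ⟨⟨m, hm⟩⟩
  set N : Fin d → ℝ := fun i => ‖ψ (unitRoot d ^ (i : ℕ) * w)‖ with hN
  -- Among the indices at which `N` is minimal the least one is taken.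
  obtain ⟨j₀, hj₀⟩ := Finite.exists_min N
  obtain ⟨j, hj, hjmin⟩ := WellFounded.has_min
    (Finite.wellFounded_of_trans_of_irrefl (α := Fin d) (· < ·))
    {j | ∀ i, N j ≤ N i}
    ⟨j₀, hj₀⟩
  have hjlt : ∀ i, i < j → N j < N i := fun i hi => by
    by_contra! hle
    exact hjmin i (fun k => hle.trans (hj k)) hi
  have hzj : ψ (unitRoot d ^ (j : ℕ) * w) ∈ Metric.ball (0 : ℂ) r := by
    have h1 := hj ⟨m, hm⟩
    simp only [hN] at h1
    rw [← hmz', h.left_inv z hzδ] at h1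
    rw [mem_ball_zero_iff] at hz ⊢
    exact h1.trans_lt hz
  have hφj := h.right_inv _ (hmem j)
  refine Set.mem_iUnion.2 ⟨j, ψ (unitRoot d ^ (j : ℕ) * w), ⟨hzj, ?_⟩, ?_⟩
  · have h2 : (unitRoot d ^ (j : ℕ))⁻¹ * φ (ψ (unitRoot d ^ (j : ℕ) * w)) = w := by
      rw [hφj, inv_mul_cancel_left₀ (unitRoot_pow_ne_zero hd0 _)]
    refine ⟨by rw [Set.mem_ofPred_eq, h2]; exact hw, Set.mem_iInter.2 fun i => ⟨fun hi => ?_, ?_⟩⟩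
    · rw [h2]
      exact hjlt i hi
    · rw [Set.mem_ofPred_eq, h2]
      exact hj i
  · rw [h.pow_eq _ (Metric.ball_subset_ball hr hzj), hφj, h.pow_eq z hzδ, ← hwd, mul_pow, ← pow_mul,
      mul_comm (j : ℕ) d, pow_mul, hζ.pow_eq_one, one_pow, one_mul]

end IsRootDomain

/-! ### The area of the image of a disk -/

theorem measurableSet_inter_lt {U : Set ℂ} (hU : IsOpen U) {g h : ℂ → ℝ} (hg : ContinuousOn g U)
    (hh : ContinuousOn h U) : MeasurableSet (U ∩ {z | g z < h z}) := by
  have : U ∩ {z | g z < h z} = U ∩ (fun z => h z - g z) ⁻¹' Set.Ioi 0 := by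
    ext z
    simp
  rw [this]
  exact ((hh.sub hg).isOpen_inter_preimage hU isOpen_Ioi).measurableSet

theorem measurableSet_inter_le {U : Set ℂ} (hU : IsOpen U) {g h : ℂ → ℝ} (hg : ContinuousOn g U)
    (hh : ContinuousOn h U) : MeasurableSet (U ∩ {z | g z ≤ h z}) := by
  have : U ∩ {z | g z ≤ h z} = U \ (U ∩ {z | h z < g z}) := by
    ext z
    simp +contextual
  rw [this]
  exact hU.measurableSet.diff (measurableSet_inter_lt hU hh hg)

theorem IsRootDomain.measurableSet_ball_inter_minimalCell {f φ ψ : ℂ → ℂ} {d : ℕ} {δ δ' r : ℝ}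
    (h : IsRootDomain f φ ψ d δ δ') (hd : 2 ≤ d) (hr : r ≤ δ) (j : Fin d) :
    MeasurableSet (Metric.ball 0 r ∩ minimalCell φ ψ j) := by
  have hd0 : d ≠ 0 := by omega
  set U := Metric.ball (0 : ℂ) r with hU
  have hUo : IsOpen U := Metric.isOpen_ball
  have hsub : U ⊆ Metric.ball 0 δ := Metric.ball_subset_ball hr
  have hφ : ContinuousOn (fun z => (unitRoot d ^ (j : ℕ))⁻¹ * φ z) U := fun z hz =>
    (continuousAt_const.mul (h.continuousAt z (hsub hz))).continuousWithinAt
  have hlin : ∀ c : ℂ, MeasurableSet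
      (U ∩ {z | 0 < (c * ((unitRoot d ^ (j : ℕ))⁻¹ * φ z)).re}) := fun c =>
    measurableSet_inter_lt hUo continuousOn_const
      (Complex.continuous_re.comp_continuousOn (continuousOn_const.mul hφ))
  have hψ : ∀ i : Fin d, ContinuousOn
      (fun z => ‖ψ (unitRoot d ^ (i : ℕ) * ((unitRoot d ^ (j : ℕ))⁻¹ * φ z))‖) U := by
    intro i
    have h1 : ContinuousOn ψ (Metric.ball 0 δ') := fun w hw =>
      (h.continuousAt_inv w hw).continuousWithinAt
    refine (h1.comp (continuousOn_const.mul hφ) fun z hz => ?_).norm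
    rw [mem_ball_zero_iff]
    change ‖unitRoot d ^ (i : ℕ) * ((unitRoot d ^ (j : ℕ))⁻¹ * φ z)‖ < δ'
    rw [norm_mul, norm_mul, norm_inv, norm_unitRoot_pow hd0,
      norm_unitRoot_pow hd0, inv_one, one_mul, one_mul]
    exact h.norm_lt z (hsub hz)
  have hid : ContinuousOn (fun z : ℂ => ‖z‖) U := continuous_norm.continuousOn
  have hcell : U ∩ minimalCell φ ψ j =
      (U ∩ {z | (unitRoot d ^ (j : ℕ))⁻¹ * φ z ∈ rootSector d}) ∩ ⋂ i : Fin d,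
        (Uᶜ ∪ ((U ∩ {z | i < j →
          ‖z‖ < ‖ψ (unitRoot d ^ (i : ℕ) * ((unitRoot d ^ (j : ℕ))⁻¹ * φ z))‖}) ∩
        (U ∩ {z | ‖z‖ ≤ ‖ψ (unitRoot d ^ (i : ℕ) * ((unitRoot d ^ (j : ℕ))⁻¹ * φ z))‖}))) := by
    ext z
    by_cases hz : z ∈ U
    · simp [minimalCell, hz]
    · simp [hz]
  rw [hcell]
  refine MeasurableSet.inter ?_ (MeasurableSet.iInter fun i =>
    hUo.measurableSet.compl.union (MeasurableSet.inter ?_ (measurableSet_inter_le hUo hid (hψ i))))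
  · have : U ∩ {z | (unitRoot d ^ (j : ℕ))⁻¹ * φ z ∈ rootSector d} =
        (U ∩ {z | 0 < (Complex.exp ((Real.pi / 2 - Real.pi / d : ℝ) * Complex.I) *
          ((unitRoot d ^ (j : ℕ))⁻¹ * φ z)).re}) ∩
        (U ∩ {z | 0 < (Complex.exp (-(Real.pi / 2 - Real.pi / d : ℝ) * Complex.I) *
          ((unitRoot d ^ (j : ℕ))⁻¹ * φ z)).re}) := by
      ext z
      simp only [rootSector, Set.mem_inter_iff, Set.mem_ofPred_eq]
      tauto
    rw [this]
    exact (hlin _).inter (hlin _)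
  · by_cases hij : i < j
    · simpa only [hij, true_imp_iff] using measurableSet_inter_lt hUo hid (hψ i)
    · simpa only [hij, false_imp_iff, Set.ofPred_true, Set.inter_univ] using hUo.measurableSet

namespace LocalRoot

variable {f φ ψ : ℂ → ℂ} {n d : ℕ}

/-- `z ↦ log (σ z / (η z))` for the germ `σ z = ψ (η φ z)`: its real part compares `|σ z|`
with `|z|`. -/
theorem exists_log_ratio (h : LocalRoot f n φ ψ) {η : ℂ} (hη : ‖η‖ = 1) :
    ∃ F : ℂ → ℂ, AnalyticAt ℂ F 0 ∧ F 0 = 0 ∧ ∀ᶠ z in 𝓝 (0 : ℂ),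
      ‖ψ (η * φ z)‖ = ‖z‖ * Real.exp (F z).re := by
  set q : ℂ → ℂ := fun z => dslope φ 0 z * dslope ψ 0 (η * φ z) with hq
  have hq0 : q 0 = 1 := by
    rw [hq]
    simp only [h.map_zero, mul_zero]
    exact h.dslope_mul_dslope
  have hqa : AnalyticAt ℂ q 0 := by
    refine h.analytic.dslope_zero.mul ?_
    refine AnalyticAt.fun_comp (g := dslope ψ 0) ?_ (analyticAt_const.mul h.analytic)
    rw [h.map_zero, mul_zero]
    exact h.analytic_inv.dslope_zero
  refine ⟨fun z => Complex.log (q z), hqa.clog (by rw [hq0]; exact Complex.one_mem_slitPlane),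
    by simp [hq0], ?_⟩
  filter_upwards [hqa.continuousAt.eventually_ne (by rw [hq0]; exact one_ne_zero)] with z hz
  rw [Complex.log_re, Real.exp_log (norm_pos_iff.2 hz), eq_mul_dslope_zero h.inv_zero (η * φ z),
    norm_mul, norm_mul, hη, one_mul, hq, norm_mul, ← mul_assoc, ← norm_mul z,
    ← eq_mul_dslope_zero h.map_zero z]

theorem isAnalyticSector_minimalCell (h : LocalRoot f n φ ψ) (hd : d ≠ 0) (j : Fin d) (θ₀ : ℝ) :
    IsAnalyticSector (minimalCell φ ψ j) θ₀ := by
  have hlin : ∀ c : ℂ,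
      IsAnalyticSector {z | 0 < (c * ((unitRoot d ^ (j : ℕ))⁻¹ * φ z)).re} θ₀ := fun c =>
    isAnalyticSector_of_re_pos (F := fun z => c * ((unitRoot d ^ (j : ℕ))⁻¹ * φ z))
      (analyticAt_const.mul (analyticAt_const.mul h.analytic)) (by simp [h.map_zero])
      (Eventually.of_forall fun z => Iff.rfl) θ₀
  refine IsAnalyticSector.inter ((hlin _).inter (hlin _)) (IsAnalyticSector.iInter fun i => ?_)
  obtain ⟨F, hF, hF0, hFz⟩ := h.exists_log_ratio
    (η := unitRoot d ^ (i : ℕ) * (unitRoot d ^ (j : ℕ))⁻¹)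
    (by rw [norm_mul, norm_inv, norm_unitRoot_pow hd, norm_unitRoot_pow hd, inv_one, one_mul])
  simp only [mul_assoc] at hFz
  refine IsAnalyticSector.inter ?_ ?_
  · by_cases hij : i < j
    · refine isAnalyticSector_of_re_pos hF hF0 ?_ θ₀
      filter_upwards [hFz.filter_mono nhdsWithin_le_nhds, self_mem_nhdsWithin] with z hz hz0
      simp only [hij, true_imp_iff]
      rw [hz, lt_mul_iff_one_lt_right (norm_pos_iff.2 hz0), Real.one_lt_exp_iff]
    · exact IsAnalyticSector.of_eventually_mem (by simp [hij])
  · refine isAnalyticSector_of_re_nonneg hF hF0 ?_ θ₀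
    filter_upwards [hFz.filter_mono nhdsWithin_le_nhds, self_mem_nhdsWithin] with z hz hz0
    rw [hz, le_mul_iff_one_le_right (norm_pos_iff.2 hz0), Real.one_le_exp_iff]

/-- The derivative vanishes to order `n - 1`. -/
theorem exists_deriv_eq (h : LocalRoot f n φ ψ) (hn : n ≠ 0) :
    ∃ k : ℂ → ℂ, AnalyticAt ℂ k 0 ∧ ∀ᶠ z in 𝓝 (0 : ℂ), deriv f z = z ^ (n - 1) * k z := by
  set u : ℂ → ℂ := fun z => dslope φ 0 z ^ n with hu
  have hua : AnalyticAt ℂ u 0 := h.analytic.dslope_zero.pow n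
  refine ⟨fun z => n * u z + z * deriv u z,
    (analyticAt_const.mul hua).add (analyticAt_id.mul hua.deriv), ?_⟩
  have hf : f =ᶠ[𝓝 0] fun z => z ^ n * u z := by
    filter_upwards [h.pow_eq] with z hz
    rw [hz, eq_mul_dslope_zero h.map_zero z, mul_pow]
  filter_upwards [hf.eventuallyEq_nhds, hua.eventually_analyticAt] with z h1 h2
  have h3 := (hasDerivAt_pow n z).mul h2.differentiableAt.hasDerivAt
  rw [h1.deriv_eq, show (fun z => z ^ n * u z) = ((fun z => z ^ n) * u : ℂ → ℂ) from rfl, h3.deriv]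
  have h4 : z ^ n = z ^ (n - 1) * z := by rw [← pow_succ, Nat.sub_add_cancel (by omega)]
  rw [h4]
  ring

end LocalRoot

theorem volume_compl_slitPlane : volume (Complex.slitPlaneᶜ : Set ℂ) = 0 := by
  have h1 : Complex.slitPlaneᶜ ⊆ ((LinearMap.ker Complex.imLm : Submodule ℝ ℂ) : Set ℂ) := by
    intro z hz
    rw [Set.mem_compl_iff, Complex.mem_slitPlane_iff, not_or, not_not] at hz
    exact hz.2
  refine measure_mono_null h1 (Measure.addHaar_submodule volume _ fun htop => ?_)
  have : Complex.I ∈ (LinearMap.ker Complex.imLm : Submodule ℝ ℂ) := by rw [htop]; trivial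
  simp at this

/-- The area formula for a holomorphic map. -/
theorem lintegral_norm_deriv_sq_eq_volume_image {f : ℂ → ℂ} {E : Set ℂ} (hE : MeasurableSet E)
    (hf : ∀ z ∈ E, DifferentiableAt ℂ f z) (hinj : Set.InjOn f E) :
    ∫⁻ z in E, ENNReal.ofReal (‖deriv f z‖ ^ 2) = volume (f '' E) := by
  have hd : ∀ z ∈ E, HasFDerivWithinAt f ((fderiv ℂ f z).restrictScalars ℝ) E z := fun z hz =>
    ((hf z hz).hasFDerivAt.restrictScalars ℝ).hasFDerivWithinAt
  rw [← lintegral_abs_det_fderiv_eq_addHaar_image volume hE hd hinj]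
  refine setLIntegral_congr_fun hE fun z _ => ?_
  congr 1
  have : ((fderiv ℂ f z).restrictScalars ℝ : ℂ →L[ℝ] ℂ).det = ‖deriv f z‖ ^ 2 := by
    rw [ContinuousLinearMap.det]
    change LinearMap.det ((fderiv ℂ f z : ℂ →ₗ[ℂ] ℂ).restrictScalars ℝ) = _
    rw [LinearMap.det_restrictScalars, LinearMap.det_ring]
    simp [Algebra.norm_complex_apply, Complex.normSq_eq_norm_sq]
  rw [this, abs_of_nonneg (by positivity)]

/-- The area of the image as a set is the integral of `|f'|²` over the points which have minimal
modulus among the preimages of their value, one for almost every value. -/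
theorem IsRootDomain.volume_image_ball {f φ ψ : ℂ → ℂ} {d : ℕ} {δ δ' r : ℝ}
    (h : IsRootDomain f φ ψ d δ δ') (hd : 2 ≤ d) (hr : r ≤ δ) :
    volume (f '' Metric.ball 0 r) =
      ∑ j : Fin d, ∫⁻ z in Metric.ball 0 r ∩ minimalCell φ ψ j,
        ENNReal.ofReal (‖deriv f z‖ ^ 2) := by
  have hmeas := fun j => h.measurableSet_ball_inter_minimalCell hd hr j
  have hdiff : ∀ j : Fin d, ∀ z ∈ Metric.ball 0 r ∩ minimalCell φ ψ j, DifferentiableAt ℂ f z :=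
    fun j z hz => (h.analytic z (Metric.ball_subset_ball hr hz.1)).differentiableAt
  have himage : ∀ j : Fin d, MeasurableSet (f '' (Metric.ball 0 r ∩ minimalCell φ ψ j)) := fun j =>
    (hmeas j).image_of_continuousOn_injOn
      (fun z hz => (hdiff j z hz).continuousAt.continuousWithinAt) (h.injOn_minimalCell hd hr j)
  have hunion : volume (f '' Metric.ball 0 r) =
      volume (⋃ j : Fin d, f '' (Metric.ball 0 r ∩ minimalCell φ ψ j)) := by
    apply le_antisymm
    · refine (measure_mono (?_ : _ ⊆ (⋃ j : Fin d, f '' (Metric.ball 0 r ∩ minimalCell φ ψ j)) ∪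
        Complex.slitPlaneᶜ)).trans ((measure_union_le _ _).trans ?_)
      · intro y hy
        by_cases hs : y ∈ Complex.slitPlane
        · exact Or.inl (h.image_ball_inter_slitPlane_subset hd hr ⟨hy, hs⟩)
        · exact Or.inr hs
      · rw [volume_compl_slitPlane, add_zero]
    · exact measure_mono (Set.iUnion_subset fun j => Set.image_mono Set.inter_subset_left)
  rw [hunion, measure_iUnion (h.pairwise_disjoint_image hd hr) himage, tsum_fintype]
  exact Finset.sum_congr rfl fun j _ =>
    (lintegral_norm_deriv_sq_eq_volume_image (hmeas j) (hdiff j) (h.injOn_minimalCell hd hr j)).symm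

/-- The radial integral of a holomorphic germ against `t ^ m` is `r ^ (m + 1)` times an analytic
germ in `r`. -/
theorem exists_analyticAt_integral_pow_mul {G : ℂ → ℂ} (hG : AnalyticAt ℂ G 0) (m : ℕ) :
    ∃ M : ℝ → ℝ, AnalyticAt ℝ M 0 ∧ ∀ᶠ r in 𝓝[>] (0 : ℝ),
      IntervalIntegrable (fun t : ℝ => t ^ m * (G t).re) volume 0 r ∧
      ∫ t in (0 : ℝ)..r, t ^ m * (G t).re = r ^ (m + 1) * M r := by
  have hM : AnalyticAt ℂ (fun z : ℂ => ∫ s in (0 : ℝ)..1, (s : ℂ) ^ m * G (z * s)) 0 := by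
    refine analyticAt_intervalIntegral (K := fun p : ℂ × ℂ => p.2 ^ m * G (p.1 * p.2))
      fun s _ => ?_
    refine (analyticAt_snd.pow m).mul ?_
    refine AnalyticAt.fun_comp (g := G) ?_ (analyticAt_fst.mul analyticAt_snd)
    simpa using hG
  refine ⟨fun r => (∫ s in (0 : ℝ)..1, (s : ℂ) ^ m * G ((r : ℂ) * s)).re, ?_, ?_⟩
  · have hM' : AnalyticAt ℂ (fun z : ℂ => ∫ s in (0 : ℝ)..1, (s : ℂ) ^ m * G (z * s))
        ((0 : ℝ) : ℂ) := by simpa using hM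
    exact hM'.re_ofReal
  obtain ⟨ε, hε, hball⟩ := Metric.eventually_nhds_iff_ball.1 hG.eventually_analyticAt
  filter_upwards [Ioo_mem_nhdsGT hε] with r hr
  have hc : ∀ t : ℝ, |t| < ε → ContinuousAt (fun t : ℝ => G t) t := fun t ht =>
    ContinuousAt.comp (f := fun t : ℝ => (t : ℂ))
      (hball t (by simpa using ht)).continuousAt Complex.continuous_ofReal.continuousAt
  have hcont : ContinuousOn (fun t : ℝ => t ^ m * (G t).re) (Set.Icc 0 r) := fun t ht => by
    refine ((continuousAt_id.pow m).mul
      (Complex.continuous_re.continuousAt.comp (hc t ?_))).continuousWithinAt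
    rw [abs_of_nonneg ht.1]
    exact ht.2.trans_lt hr.2
  refine ⟨hcont.intervalIntegrable_of_Icc hr.1.le, ?_⟩
  have hint : IntervalIntegrable (fun s : ℝ => (s : ℂ) ^ m * G ((r : ℂ) * s)) volume 0 1 := by
    refine ContinuousOn.intervalIntegrable_of_Icc zero_le_one fun s hs => ?_
    have h1 : ContinuousAt (fun s : ℝ => G ((r * s : ℝ) : ℂ)) s := by
      refine ContinuousAt.comp (f := fun s : ℝ => r * s) (g := fun t : ℝ => G t) (hc _ ?_)
        (continuousAt_const.mul continuousAt_id)
      rw [abs_of_nonneg (mul_nonneg hr.1.le hs.1)]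
      exact (mul_le_of_le_one_right hr.1.le hs.2).trans_lt hr.2
    push_cast at h1
    exact ((Complex.continuous_ofReal.continuousAt.pow m).mul h1).continuousWithinAt
  have h2 := Complex.reCLM.intervalIntegral_comp_comm hint
  simp only [Complex.reCLM_apply] at h2
  rw [← h2]
  have h3 := intervalIntegral.smul_integral_comp_mul_left (a := 0) (b := 1)
    (fun t : ℝ => t ^ m * (G t).re) r
  rw [mul_zero, mul_one] at h3
  rw [← h3, smul_eq_mul, pow_succ', mul_assoc, ← intervalIntegral.integral_const_mul (r ^ m)]
  congr 1
  refine intervalIntegral.integral_congr fun s _ => ?_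
  rw [← Complex.ofReal_pow, Complex.re_ofReal_mul, mul_pow]
  push_cast
  ring

/-- The weighted area of the part of an analytic sector in a small disk, computed in polar
coordinates. -/
theorem exists_analyticAt_lintegral_sector {T : Set ℂ} (hT : ∀ θ₀, IsAnalyticSector T θ₀)
    {δ : ℝ} (hδ : 0 < δ) (hTm : ∀ r ≤ δ, MeasurableSet (Metric.ball 0 r ∩ T)) {D k : ℂ → ℂ}
    (hD : Measurable D) (hk : AnalyticAt ℂ k 0) {m : ℕ}
    (hDk : ∀ᶠ z in 𝓝 (0 : ℂ), D z = z ^ m * k z) :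
    ∃ M : ℝ → ℝ, AnalyticAt ℝ M 0 ∧ ∀ᶠ r in 𝓝[>] (0 : ℝ), 0 ≤ r ^ (2 * m + 2) * M r ∧
      ∫⁻ z in Metric.ball 0 r ∩ T, ENNReal.ofReal (‖D z‖ ^ 2) =
        ENNReal.ofReal (r ^ (2 * m + 2) * M r) := by
  have hpi : -Real.pi ≤ Real.pi := by linarith [Real.pi_pos]
  obtain ⟨G, hG, hGr⟩ := hasAnalyticAngularIntegral hT hk hpi
  obtain ⟨M, hM, hMr⟩ := exists_analyticAt_integral_pow_mul hG (2 * m + 1)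
  refine ⟨M, hM, ?_⟩
  obtain ⟨ε, hε, hball⟩ := Metric.eventually_nhds_iff_ball.1 hDk
  obtain ⟨ε', hε', hG'⟩ := mem_nhdsGT_iff_exists_Ioo_subset.1 hGr
  filter_upwards [hMr, Ioo_mem_nhdsGT (lt_min hδ (lt_min hε hε'))] with r hMr hr
  have hrδ : r ≤ δ := hr.2.le.trans (min_le_left _ _)
  have hrε : r ≤ ε := hr.2.le.trans ((min_le_right _ _).trans (min_le_left _ _))
  have hrε' : r ≤ ε' := hr.2.le.trans ((min_le_right _ _).trans (min_le_right _ _))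
  set E := Metric.ball (0 : ℂ) r ∩ T with hE
  have hEm : MeasurableSet E := hTm r hrδ
  set w : ℂ → ENNReal := fun z => ENNReal.ofReal (‖D z‖ ^ 2) with hw
  have hwm : Measurable w := (hD.norm.pow_const 2).ennreal_ofReal
  have hsd : ∀ t θ, 0 ≤ sectorDensity T k t θ := fun t θ =>
    Set.indicator_nonneg (fun z _ => by positivity) _
  have hGt : ∀ t ∈ Set.Ioo 0 r, IntervalIntegrable (sectorDensity T k t) volume (-Real.pi) Real.pi ∧
      (G t).re = ∫ θ in -Real.pi..Real.pi, sectorDensity T k t θ := fun t ht => by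
    have h := hG' (⟨ht.1, ht.2.trans_le hrε'⟩ : t ∈ Set.Ioo 0 ε')
    exact ⟨h.1, by rw [h.2, Complex.ofReal_re]⟩
  have hnonneg : ∀ t ∈ Set.Ioo 0 r, 0 ≤ t ^ (2 * m + 1) * (G t).re := fun t ht => by
    rw [(hGt t ht).2]
    exact mul_nonneg (pow_nonneg ht.1.le _)
      (intervalIntegral.integral_nonneg hpi fun θ _ => hsd t θ)
  have hpt : ∀ t ∈ Set.Ioo 0 r, ∀ θ, ENNReal.ofReal t * E.indicator w (polarPoint t θ) =
      ENNReal.ofReal (t ^ (2 * m + 1) * sectorDensity T k t θ) := by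
    intro t ht θ
    have hn : ‖polarPoint t θ‖ = t := by rw [norm_polarPoint, abs_of_pos ht.1]
    have hmem : polarPoint t θ ∈ Metric.ball (0 : ℂ) r := by
      rw [mem_ball_zero_iff, hn]
      exact ht.2
    by_cases hTz : polarPoint t θ ∈ T
    · have hEz : polarPoint t θ ∈ E := ⟨hmem, hTz⟩
      rw [sectorDensity, Set.indicator_of_mem hTz, Set.indicator_of_mem hEz, hw,
        ← ENNReal.ofReal_mul ht.1.le,
        hball _ (Metric.ball_subset_ball hrε hmem), norm_mul, norm_pow, hn]
      congr 1
      ring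
    · rw [sectorDensity, Set.indicator_of_notMem hTz,
        Set.indicator_of_notMem (fun h : polarPoint t θ ∈ E => hTz h.2)]
      simp
  -- For `t ≥ r` the circle of radius `t` misses the open disk.
  have hinner : ∀ t ∈ Set.Ioi (0 : ℝ),
      ∫⁻ θ in Set.Ioo (-Real.pi) Real.pi, ENNReal.ofReal t * E.indicator w (polarPoint t θ) =
        (Set.Ioo 0 r).indicator (fun t => ENNReal.ofReal (t ^ (2 * m + 1) * (G t).re)) t := by
    intro t ht
    by_cases htr : t < r
    · have ht' : t ∈ Set.Ioo 0 r := ⟨ht, htr⟩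
      rw [Set.indicator_of_mem ht', (hGt t ht').2]
      simp only [hpt t ht']
      rw [← intervalIntegral.integral_const_mul, intervalIntegral.integral_of_le hpi,
        restrict_Ioo_eq_restrict_Ioc]
      symm
      refine ofReal_integral_eq_lintegral_ofReal ?_ (Eventually.of_forall fun θ =>
        mul_nonneg (pow_nonneg ht'.1.le _) (hsd t θ))
      exact (((intervalIntegrable_iff_integrableOn_Ioc_of_le hpi).1 (hGt t ht').1).const_mul _)
    · rw [Set.indicator_of_notMem (fun h => htr h.2)]
      refine (lintegral_congr fun θ => ?_).trans lintegral_zero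
      rw [Set.indicator_of_notMem, mul_zero]
      intro h
      have := mem_ball_zero_iff.1 h.1
      rw [norm_polarPoint, abs_of_pos ht] at this
      exact htr this
  have hpolar : ∀ p : ℝ × ℝ, Complex.polarCoord.symm p = polarPoint p.1 p.2 := fun p => by
    rw [Complex.polarCoord_symm_apply, polarPoint, Complex.exp_mul_I, Complex.ofReal_cos,
      Complex.ofReal_sin]
  have hpm : Measurable fun p : ℝ × ℝ => polarPoint p.1 p.2 :=
    contDiff_polarPoint.continuous.measurable
  have hfm : Measurable fun p : ℝ × ℝ =>
      ENNReal.ofReal p.1 * E.indicator w (polarPoint p.1 p.2) :=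
    measurable_fst.ennreal_ofReal.mul ((hwm.indicator hEm).comp hpm)
  have hval : ∫⁻ z in E, w z = ENNReal.ofReal (r ^ (2 * m + 1 + 1) * M r) := by
    rw [← lintegral_indicator hEm, ← Complex.lintegral_comp_polarCoord_symm]
    simp only [hpolar, smul_eq_mul]
    rw [polarCoord_target, Measure.volume_eq_prod, setLIntegral_prod _ hfm.aemeasurable,
      setLIntegral_congr_fun measurableSet_Ioi hinner, lintegral_indicator measurableSet_Ioo,
      Measure.restrict_restrict measurableSet_Ioo,
      Set.inter_eq_self_of_subset_left Set.Ioo_subset_Ioi_self, ← hMr.2,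
      intervalIntegral.integral_of_le hr.1.le, ← restrict_Ioo_eq_restrict_Ioc]
    symm
    refine ofReal_integral_eq_lintegral_ofReal ?_
      ((ae_restrict_mem measurableSet_Ioo).mono hnonneg)
    rw [restrict_Ioo_eq_restrict_Ioc]
    exact (intervalIntegrable_iff_integrableOn_Ioc_of_le hr.1.le).1 hMr.1
  refine ⟨?_, hval⟩
  rw [← hMr.2, intervalIntegral.integral_of_le hr.1.le, ← restrict_Ioo_eq_restrict_Ioc]
  exact integral_nonneg_of_ae ((ae_restrict_mem measurableSet_Ioo).mono hnonneg)

namespace LocalRoot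

variable {f φ ψ : ℂ → ℂ} {d : ℕ}

theorem analyticAt (h : LocalRoot f d φ ψ) : AnalyticAt ℂ f 0 :=
  (h.analytic.pow d).congr (h.pow_eq.mono fun _ hz => hz.symm)

/-- The area of the image of a small disk is `r ^ (2 * d)` times a real-analytic germ. -/
theorem exists_analyticAt_volume_image (h : LocalRoot f d φ ψ) (hd : 2 ≤ d) :
    ∃ M : ℝ → ℝ, AnalyticAt ℝ M 0 ∧
      ∀ᶠ r in 𝓝[>] (0 : ℝ), volume.real (f '' Metric.ball 0 r) = r ^ (2 * d) * M r := by
  obtain ⟨δ, hδ, δ', hdom⟩ := h.exists_isRootDomain h.analyticAt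
  obtain ⟨k, hk, hfk⟩ := h.exists_deriv_eq (by omega)
  choose M hM hMr using fun j : Fin d => exists_analyticAt_lintegral_sector
    (h.isAnalyticSector_minimalCell (by omega) j) hδ
    (fun r hr => hdom.measurableSet_ball_inter_minimalCell hd hr j) (measurable_deriv f) hk hfk
  refine ⟨fun r => ∑ j, M j r, Finset.analyticAt_fun_sum _ fun j _ => hM j, ?_⟩
  filter_upwards [eventually_all.2 hMr, Ioo_mem_nhdsGT hδ] with r hr hrδ
  have hdd : 2 * (d - 1) + 2 = 2 * d := by omega
  simp only [hdd] at hr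
  rw [Measure.real, hdom.volume_image_ball hd hrδ.2.le, Finset.sum_congr rfl fun j _ => (hr j).2,
    ← ENNReal.ofReal_sum_of_nonneg fun j _ => (hr j).1,
    ENNReal.toReal_ofReal (Finset.sum_nonneg fun j _ => (hr j).1), Finset.mul_sum]

/-- The mean radius is `r ^ d` times a positive real-analytic germ. -/
theorem exists_analyticAt_meanRadius (h : LocalRoot f d φ ψ) (hd : 2 ≤ d) :
    ∃ σ : ℝ → ℝ, AnalyticAt ℝ σ 0 ∧ 0 < σ 0 ∧
      ∀ᶠ r in 𝓝[>] (0 : ℝ), meanRadius f 0 r = r ^ d * σ r := by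
  obtain ⟨M, hM, hMr⟩ := h.exists_analyticAt_volume_image hd
  have hc0 : 0 < ‖dslope φ 0 0‖ ^ d := pow_pos (norm_pos_iff.2 h.dslope_ne_zero) d
  have hmean : ∀ᶠ r in 𝓝[>] (0 : ℝ), meanRadius f 0 r = r ^ d * Real.sqrt (M r / Real.pi) := by
    filter_upwards [hMr, self_mem_nhdsWithin] with r h1 h2
    have h3 : (0 : ℝ) ≤ r ^ d := pow_nonneg (le_of_lt h2) d
    rw [meanRadius, h1, mul_div_assoc, mul_comm 2 d, pow_mul, Real.sqrt_mul (sq_nonneg _),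
      Real.sqrt_sq h3]
  -- The value at `0` is known from the leading order of the mean radius.
  have hM0 : 0 < M 0 / Real.pi := by
    have h1 : Tendsto (fun r => Real.sqrt (M r / Real.pi)) (𝓝[>] 0)
        (𝓝 (Real.sqrt (M 0 / Real.pi))) :=
      ((hM.continuousAt.div_const _).sqrt.tendsto).mono_left nhdsWithin_le_nhds
    have h2 : Tendsto (fun r => Real.sqrt (M r / Real.pi)) (𝓝[>] 0) (𝓝 (‖dslope φ 0 0‖ ^ d)) := by
      refine (h.tendsto_meanRadius (by omega)).congr' ?_
      filter_upwards [hmean, self_mem_nhdsWithin] with r h3 h4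
      rw [h3, mul_div_cancel_left₀ _ (pow_pos h4 d).ne']
    rw [tendsto_nhds_unique h2 h1] at hc0
    exact Real.sqrt_pos.1 hc0
  refine ⟨fun r => Real.sqrt (M r / Real.pi), ?_, Real.sqrt_pos.2 hM0, hmean⟩
  exact ((hM.div_const (c := Real.pi)).contDiffAt.sqrt hM0.ne').analyticAt

end LocalRoot

theorem meanRadius_zero (f : ℂ → ℂ) (z₀ : ℂ) : meanRadius f z₀ 0 = 0 := by
  simp [meanRadius]

/-! ### The Böttcher coordinate of the radial map -/

/-- Böttcher coordinate of `ρ(r) = r ^ d * σ(r)` at its superattracting fixed point `0`: the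
function `h(r) = r * e(r)` satisfies `h (ρ r) = h r ^ d`. It is `e = exp Ψ` with
`Ψ = ∑ d ^ (-n - 1) * log (σ ∘ ρ^[n])`, a series that converges uniformly near `0` in `ℂ`. -/
theorem exists_boettcher {σ : ℝ → ℝ} (hσ : AnalyticAt ℝ σ 0) (hσ0 : 0 < σ 0) {d : ℕ}
    (hd : 2 ≤ d) :
    ∃ e : ℝ → ℝ, AnalyticAt ℝ e 0 ∧ 0 < e 0 ∧
      ∀ᶠ r in 𝓝 (0 : ℝ), σ r * e (r ^ d * σ r) = e r ^ d := by
  obtain ⟨s, hs, hsσ⟩ := hσ.exists_complexification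
  have hs0 : s 0 = σ 0 := by simpa using hsσ.self_of_nhds
  have hsre : 0 < (s 0).re := by rw [hs0]; exact hσ0
  have hd0 : (d : ℝ) ≠ 0 := by positivity
  set P : ℂ → ℂ := fun z => z ^ d * s z with hP
  have hsmall : ∀ᶠ z in 𝓝 (0 : ℂ), ‖z ^ (d - 1) * s z‖ < 1 := by
    have : ContinuousAt (fun z : ℂ => ‖z ^ (d - 1) * s z‖) 0 :=
      ((continuousAt_id.pow (d - 1)).mul hs.continuousAt).norm
    refine this.eventually_lt_const ?_
    simp [zero_pow (by omega : d - 1 ≠ 0)]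
  have hre : ∀ᶠ z in 𝓝 (0 : ℂ), 0 < (s z).re :=
    (Complex.continuous_re.continuousAt.comp hs.continuousAt).eventually_const_lt hsre
  have hlog0 : AnalyticAt ℂ (fun z => Complex.log (s z)) 0 := hs.clog (Or.inl hsre)
  have hbd : ∀ᶠ z in 𝓝 (0 : ℂ), ‖Complex.log (s z)‖ < ‖Complex.log (s 0)‖ + 1 :=
    hlog0.continuousAt.norm.eventually_lt_const (lt_add_one _)
  obtain ⟨δ₁, hδ₁, hball⟩ := Metric.eventually_nhds_iff_ball.1
    ((((hsmall.and hre).and hbd).and hs.eventually_analyticAt).and hlog0.eventually_analyticAt)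
  obtain ⟨δ₂, hδ₂, hreal⟩ := Metric.eventually_nhds_iff_ball.1 hsσ
  set δ := min δ₁ δ₂ with hδ
  have hδ0 : 0 < δ := lt_min hδ₁ hδ₂
  set B := Metric.ball (0 : ℂ) δ with hB
  have hB1 : ∀ z ∈ B, z ∈ Metric.ball (0 : ℂ) δ₁ :=
    fun z hz => Metric.ball_subset_ball (min_le_left _ _) hz
  have hmaps : Set.MapsTo P B B := by
    intro z hz
    have h1 := (hball z (hB1 z hz)).1.1.1.1
    rw [hB, mem_ball_zero_iff] at hz ⊢
    have h2 : P z = z * (z ^ (d - 1) * s z) := by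
      rw [hP, ← mul_assoc, ← pow_succ', Nat.sub_add_cancel (by omega)]
    rw [h2, norm_mul]
    exact (mul_le_of_le_one_right (norm_nonneg z) h1.le).trans_lt hz
  have hPd : DifferentiableOn ℂ P B := fun z hz =>
    ((differentiableAt_id.pow d).mul
      (hball z (hB1 z hz)).1.2.differentiableAt).differentiableWithinAt
  have hiter : ∀ n, Set.MapsTo P^[n] B B ∧ DifferentiableOn ℂ P^[n] B := by
    intro n
    induction n with
    | zero => exact ⟨Set.mapsTo_id B, differentiableOn_id⟩
    | succ n ih =>
      rw [Function.iterate_succ]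
      exact ⟨ih.1.comp hmaps, ih.2.comp hPd hmaps⟩
  have hlogd : DifferentiableOn ℂ (fun z => Complex.log (s z)) B := fun z hz =>
    (hball z (hB1 z hz)).2.differentiableAt.differentiableWithinAt
  set q : ℝ := (d : ℝ)⁻¹ with hq
  have hq0 : 0 < q := inv_pos.2 (by positivity)
  have hq1 : q < 1 := inv_lt_one_of_one_lt₀ (by exact_mod_cast (by omega : 1 < d))
  set F : ℕ → ℂ → ℂ := fun n z => (q : ℂ) ^ (n + 1) * Complex.log (s (P^[n] z)) with hF
  set C := ‖Complex.log (s 0)‖ + 1 with hC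
  have hsum : Summable fun n : ℕ => q ^ (n + 1) * C :=
    ((summable_nat_add_iff 1).2 (summable_geometric_of_lt_one hq0.le hq1)).mul_right C
  have hFle : ∀ n z, z ∈ B → ‖F n z‖ ≤ q ^ (n + 1) * C := by
    intro n z hz
    rw [hF, norm_mul, norm_pow, Complex.norm_real, Real.norm_of_nonneg hq0.le]
    have := (hball _ (hB1 _ ((hiter n).1 hz))).1.1.2.le
    gcongr
  set Ψ : ℂ → ℂ := fun z => ∑' n, F n z with hΨ
  have hΨd : DifferentiableOn ℂ Ψ B :=
    Complex.differentiableOn_tsum_of_summable_norm hsum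
      (fun n => (hlogd.comp (hiter n).2 (hiter n).1).const_mul _) Metric.isOpen_ball hFle
  have hFs : ∀ z ∈ B, Summable fun n => F n z := fun z hz =>
    Summable.of_norm_bounded hsum fun n => hFle n z hz
  have hfun : ∀ z ∈ B, (d : ℂ) * Ψ z = Complex.log (s z) + Ψ (P z) := by
    intro z hz
    have hqd : (d : ℂ) * (q : ℂ) = 1 := by
      rw [hq]
      push_cast
      exact mul_inv_cancel₀ (by exact_mod_cast hd0)
    have h1 : ∀ n, (d : ℂ) * F (n + 1) z = F n (P z) := by
      intro n
      rw [hF]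
      simp only [Function.iterate_succ_apply]
      rw [pow_succ _ (n + 1)]
      linear_combination
        ((q : ℂ) ^ (n + 1) * Complex.log (s (P^[n] (P z)))) * hqd
    rw [hΨ]
    simp only
    rw [(hFs z hz).tsum_eq_zero_add, mul_add, ← tsum_mul_left]
    simp only [h1]
    congr 1
    rw [hF]
    simp only [Function.iterate_zero_apply, zero_add, pow_one]
    rw [← mul_assoc, hqd, one_mul]
  have hBreal : ∀ r : ℝ, |r| < δ → s r = σ r ∧ 0 < σ r := by
    intro r hr
    have h1 := hreal r (by
      rw [Metric.mem_ball, Real.dist_0_eq_abs]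
      exact hr.trans_le (min_le_right _ _))
    have h2 := (hball r (hB1 _ (by
      rw [hB, mem_ball_zero_iff, Complex.norm_real]
      exact hr))).1.1.1.2
    rw [h1, Complex.ofReal_re] at h2
    exact ⟨h1, h2⟩
  have hmemB : ∀ r : ℝ, |r| < δ → (r : ℂ) ∈ B := fun r hr => by
    rw [hB, mem_ball_zero_iff, Complex.norm_real]
    exact hr
  have hPr : ∀ r : ℝ, |r| < δ → P r = ((r ^ d * σ r : ℝ) : ℂ) := fun r hr => by
    rw [hP]
    simp only
    rw [(hBreal r hr).1]
    push_cast
    rfl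
  have hPδ : ∀ r : ℝ, |r| < δ → |r ^ d * σ r| < δ := fun r hr => by
    have := hmaps (hmemB r hr)
    rwa [hPr r hr, hB, mem_ball_zero_iff, Complex.norm_real] at this
  have hiterreal : ∀ n : ℕ, ∀ r : ℝ, |r| < δ → ∃ t : ℝ, P^[n] r = t ∧ |t| < δ := by
    intro n
    induction n with
    | zero => exact fun r hr => ⟨r, rfl, hr⟩
    | succ n ih =>
      intro r hr
      obtain ⟨t, ht, ht'⟩ := ih _ (hPδ r hr)
      exact ⟨t, by rw [Function.iterate_succ_apply, hPr r hr, ht], ht'⟩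
  -- On the real axis all terms of the series are real.
  have hΨim : ∀ r : ℝ, |r| < δ → Ψ r = ((Ψ r).re : ℂ) := by
    intro r hr
    refine Complex.ext rfl ?_
    rw [Complex.ofReal_im, hΨ]
    simp only
    rw [Complex.im_tsum (hFs r (hmemB r hr))]
    refine (tsum_congr fun n => ?_).trans tsum_zero
    obtain ⟨t, ht, ht'⟩ := hiterreal n r hr
    rw [hF]
    simp only
    rw [ht, (hBreal t ht').1, ← Complex.ofReal_log (hBreal t ht').2.le, ← Complex.ofReal_pow,
      ← Complex.ofReal_mul, Complex.ofReal_im]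
  have h0B : (0 : ℂ) ∈ B := Metric.mem_ball_self hδ0
  have hΨan : AnalyticAt ℂ Ψ 0 := hΨd.analyticAt (Metric.ball_mem_nhds 0 hδ0)
  refine ⟨fun r => Real.exp (Ψ r).re, ?_, Real.exp_pos _, ?_⟩
  · refine AnalyticAt.rexp ?_
    have : AnalyticAt ℂ Ψ ((0 : ℝ) : ℂ) := by simpa using hΨan
    exact this.re_ofReal
  · filter_upwards [Metric.ball_mem_nhds (0 : ℝ) hδ0] with r hr
    rw [Metric.mem_ball, Real.dist_0_eq_abs] at hr
    obtain ⟨h1, h2⟩ := hBreal r hr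
    have h3 := hfun r (hmemB r hr)
    rw [h1, ← Complex.ofReal_log h2.le, hPr r hr, hΨim r hr, hΨim _ (hPδ r hr)] at h3
    have h4 : (d : ℝ) * (Ψ r).re = Real.log (σ r) + (Ψ ((r ^ d * σ r : ℝ) : ℂ)).re := by
      exact_mod_cast h3
    rw [← Real.exp_nat_mul, h4, Real.exp_add, Real.exp_log h2]

/-! ### Radial maps and the conjugacy -/

/-- The planar map `r e^{iθ} ↦ κ r e(r) e^{iθ}`. -/
noncomputable def radialMap (κ : ℂ) (e : ℝ → ℝ) (z : ℂ) : ℂ := κ * z * (e ‖z‖ : ℂ)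

/-- At the origin the norm is not differentiable, but its derivative stays bounded and enters
multiplied by `z`. -/
theorem contDiffAt_one_radialMap_zero (κ : ℂ) {e : ℝ → ℝ} (he : AnalyticAt ℝ e 0) :
    ContDiffAt ℝ 1 (radialMap κ e) 0 := by
  rw [contDiffAt_one_iff]
  obtain ⟨ε, hε, hball⟩ := Metric.eventually_nhds_iff_ball.1 he.eventually_analyticAt
  have hmem : ∀ z ∈ Metric.ball (0 : ℂ) ε, AnalyticAt ℝ e ‖z‖ := fun z hz =>
    hball _ (by simpa using hz)
  set L : ℂ →L[ℝ] ℂ := κ • ContinuousLinearMap.id ℝ ℂ with hL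
  set N : ℂ → ℂ →L[ℝ] ℂ := fun z =>
    (κ * z) • (Complex.ofRealCLM ∘L (deriv e ‖z‖ • fderiv ℝ (fun z : ℂ => ‖z‖) z)) with hN
  have hN0 : N 0 = 0 := by
    ext w
    simp [hN]
  refine ⟨fun z => e ‖z‖ • L + N z, Metric.ball 0 ε, Metric.ball_mem_nhds 0 hε, ?_, ?_⟩
  · intro z hz
    refine ContinuousAt.continuousWithinAt (ContinuousAt.add ?_ ?_)
    · exact ((hmem z hz).continuousAt.comp continuous_norm.continuousAt).smul continuousAt_const
    · have hd : ContinuousAt (fun z : ℂ => deriv e ‖z‖) z :=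
        ContinuousAt.comp (f := fun z : ℂ => ‖z‖) (hmem z hz).deriv.continuousAt
          continuous_norm.continuousAt
      by_cases hz0 : z = 0
      · subst hz0
        rw [ContinuousAt, hN0]
        have hb : ∀ w, ‖N w‖ ≤ ‖κ‖ * ‖w‖ * |deriv e ‖w‖| := by
          intro w
          have h1 : ‖fderiv ℝ (fun z : ℂ => ‖z‖) w‖ ≤ 1 := by
            simpa using norm_fderiv_le_of_lipschitz ℝ (lipschitzWith_one_norm (E := ℂ)) (x₀ := w)
          rw [hN]
          simp only
          rw [norm_smul, norm_mul]
          refine mul_le_mul_of_nonneg_left ?_ (by positivity)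
          refine (ContinuousLinearMap.opNorm_comp_le _ _).trans ?_
          rw [Complex.ofRealCLM_norm, one_mul, norm_smul, Real.norm_eq_abs]
          exact mul_le_of_le_one_right (abs_nonneg _) h1
        refine squeeze_zero_norm hb ?_
        have h2 : ContinuousAt (fun w : ℂ => ‖κ‖ * ‖w‖ * |deriv e ‖w‖|) 0 :=
          (continuousAt_const.mul continuous_norm.continuousAt).mul hd.abs
        have := h2.tendsto
        simpa using this
      · have hn : ContinuousAt (fderiv ℝ (fun z : ℂ => ‖z‖)) z :=
          ((contDiffAt_norm ℝ hz0 (n := 1)).fderiv_right (m := 0) le_rfl).continuousAt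
        exact (continuousAt_const.mul continuousAt_id).smul
          (continuousAt_const.clm_comp (hd.smul hn))
  · intro z hz
    by_cases hz0 : z = 0
    · subst hz0
      simp only [hN0, norm_zero, add_zero]
      rw [hasFDerivAt_iff_isLittleO_nhds_zero]
      have h1 : (fun h : ℂ => radialMap κ e (0 + h) - radialMap κ e 0 - (e 0 • L) h) =
          fun h => (κ * ((e ‖h‖ - e 0 : ℝ) : ℂ)) * h := by
        funext h
        simp only [radialMap, hL, zero_add, smul_apply,
          ContinuousLinearMap.id_apply, smul_eq_mul, Complex.real_smul]
        push_cast
        ring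
      rw [h1]
      have h2 : Tendsto (fun h : ℂ => κ * ((e ‖h‖ - e 0 : ℝ) : ℂ)) (𝓝 0) (𝓝 0) := by
        have h3 : ContinuousAt (fun h : ℂ => κ * ((e ‖h‖ - e 0 : ℝ) : ℂ)) 0 := by
          refine continuousAt_const.mul (Complex.continuous_ofReal.continuousAt.comp ?_)
          exact (ContinuousAt.comp (f := fun z : ℂ => ‖z‖) (hmem 0 hz).continuousAt
            continuous_norm.continuousAt).sub continuousAt_const
        have := h3.tendsto
        simpa using this
      have h4 := ((Asymptotics.isLittleO_one_iff ℂ).2 h2).mul_isBigO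
        (Asymptotics.isBigO_refl (fun h : ℂ => h) (𝓝 0))
      simpa using h4
    · have hnorm : HasFDerivAt (fun z : ℂ => ‖z‖) (fderiv ℝ (fun z : ℂ => ‖z‖) z) z :=
        ((contDiffAt_norm ℝ hz0 (n := 1)).differentiableAt one_ne_zero).hasFDerivAt
      have he' : HasFDerivAt (fun z : ℂ => e ‖z‖) (deriv e ‖z‖ • fderiv ℝ (fun z : ℂ => ‖z‖) z) z :=
        (hmem z hz).differentiableAt.hasDerivAt.comp_hasFDerivAt z hnorm
      have hc := Complex.ofRealCLM.hasFDerivAt.comp z he'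
      have hl : HasFDerivAt (fun z : ℂ => κ * z) L z := L.hasFDerivAt
      refine (hl.mul hc).congr_fderiv ?_
      ext w
      simp [hN, hL]
      ring

theorem contDiffAt_radialMap (κ : ℂ) {e : ℝ → ℝ} {z : ℂ} (hz : z ≠ 0) (he : AnalyticAt ℝ e ‖z‖)
    {m : WithTop ℕ∞} : ContDiffAt ℝ m (radialMap κ e) z := by
  have h1 : ContDiffAt ℝ m (fun z : ℂ => e ‖z‖) z :=
    ContDiffAt.comp (f := fun z : ℂ => ‖z‖) z he.contDiffAt (contDiffAt_norm ℝ hz)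
  exact (contDiffAt_const.mul contDiffAt_id).mul (Complex.ofRealCLM.contDiff.contDiffAt.comp z h1)

/-- In polar coordinates the map is `κ r e(r) e^{iθ}`; the constraint `r ≥ 0` is needed since
`‖r e^{iθ}‖ = |r|`. -/
theorem smoothInPolar_radialMap (κ : ℂ) {e : ℝ → ℝ} {ε : ℝ}
    (he : ∀ t ∈ Metric.ball (0 : ℝ) ε, AnalyticAt ℝ e t) {V : Set ℂ}
    (hV : V ⊆ Metric.ball 0 ε) : SmoothInPolar (radialMap κ e) V := by
  have hmem : ∀ z ∈ V, AnalyticAt ℝ e ‖z‖ := fun z hz => he _ (by simpa using hV hz)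
  refine ⟨fun z hz => ?_, fun z hz => ?_, ?_⟩
  · by_cases hz0 : z = 0
    · subst hz0
      exact (contDiffAt_one_radialMap_zero κ (by simpa using hmem 0 hz)).contDiffWithinAt
    · exact (contDiffAt_radialMap κ hz0 (hmem z hz)).contDiffWithinAt
  · exact (contDiffAt_radialMap κ hz.2 (hmem z hz.1)).contDiffWithinAt
  · have hn : ∀ p : ℝ × ℝ, 0 ≤ p.1 →
        ‖(p.1 * Complex.exp (p.2 * Complex.I) : ℂ)‖ = p.1 := fun p hp => by
      rw [norm_mul, Complex.norm_exp_ofReal_mul_I, mul_one, Complex.norm_real,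
        Real.norm_of_nonneg hp]
    have hof : ContDiff ℝ ∞ (fun x : ℝ => (x : ℂ)) := Complex.ofRealCLM.contDiff
    have hsm : ContDiffOn ℝ ∞ (fun p : ℝ × ℝ =>
        κ * (p.1 * Complex.exp (p.2 * Complex.I)) * (e p.1 : ℂ))
        {p : ℝ × ℝ | 0 ≤ p.1 ∧ (p.1 * Complex.exp (p.2 * Complex.I) : ℂ) ∈ V} := by
      rintro p ⟨hp, hpV⟩
      refine ContDiffAt.contDiffWithinAt ?_
      have h1 : ContDiffAt ℝ ∞ e p.1 := by
        have := hmem _ hpV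
        rw [hn p hp] at this
        exact this.contDiffAt
      have h2 : ContDiff ℝ ∞ (fun p : ℝ × ℝ => κ * (p.1 * Complex.exp (p.2 * Complex.I))) :=
        contDiff_const.mul ((hof.comp contDiff_fst).mul
          (((hof.comp contDiff_snd).mul contDiff_const).cexp))
      exact h2.contDiffAt.mul
        (hof.contDiffAt.comp p (ContDiffAt.comp p h1 contDiff_fst.contDiffAt))
    refine hsm.congr fun p hp => ?_
    rw [radialMap, hn p hp.1]

/-- The inverse of `t ↦ t * e t` near `0`, written as `t ↦ t * e' t`. -/
theorem AnalyticAt.exists_radial_inverse {e : ℝ → ℝ} (he : AnalyticAt ℝ e 0) (he0 : 0 < e 0) :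
    ∃ e' : ℝ → ℝ, AnalyticAt ℝ e' 0 ∧ 0 < e' 0 ∧
      (∀ᶠ t in 𝓝 (0 : ℝ), e t * e' (t * e t) = 1) ∧
      ∀ᶠ t in 𝓝 (0 : ℝ), e' t * e (t * e' t) = 1 := by
  have hh : AnalyticAt ℝ (fun t => t * e t) 0 := analyticAt_id.mul he
  have hd : HasDerivAt (fun t => t * e t) (e 0) 0 := by
    have := (hasDerivAt_id (0 : ℝ)).mul he.differentiableAt.hasDerivAt
    simp only [id, one_mul, zero_mul, add_zero] at this
    exact this
  have hd0 : deriv (fun t => t * e t) 0 ≠ 0 := by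
    rw [hd.deriv]
    exact he0.ne'
  set k := hh.hasStrictDerivAt.localInverse _ _ _ hd0 with hk
  have hk0 : k 0 = 0 := by
    have := HasStrictFDerivAt.localInverse_apply_image
      (hh.hasStrictDerivAt.hasStrictFDerivAt_equiv hd0)
    simp only [zero_mul] at this
    exact this
  have hkan : AnalyticAt ℝ k 0 := by
    simpa only [zero_mul] using hh.analyticAt_localInverse hd0
  have hleft : ∀ᶠ t in 𝓝 (0 : ℝ), k (t * e t) = t :=
    hh.hasStrictDerivAt.eventually_left_inverse hd0
  have hright : ∀ᶠ t in 𝓝 (0 : ℝ), k t * e (k t) = t := by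
    have := hh.hasStrictDerivAt.eventually_right_inverse hd0
    simpa only [zero_mul] using this
  have hk' := eq_mul_dslope_zero hk0
  have hean : AnalyticAt ℝ (dslope k 0) 0 := hkan.dslope_zero
  have h00 : e 0 * dslope k 0 0 = 1 := by
    have h1 : HasDerivAt k (deriv k 0) ((fun t => t * e t) 0) := by
      simpa only [zero_mul] using hkan.differentiableAt.hasDerivAt
    have h2 := h1.comp 0 hd
    have h3 : HasDerivAt (k ∘ fun t => t * e t) 1 0 :=
      (hasDerivAt_id (0 : ℝ)).congr_of_eventuallyEq hleft
    rw [dslope_same, mul_comm]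
    exact h2.unique h3
  refine ⟨dslope k 0, hean, ?_, ?_, ?_⟩
  · exact pos_of_mul_pos_right (by rw [h00]; exact one_pos) he0.le
  · filter_upwards [hleft] with t ht
    by_cases ht0 : t = 0
    · subst ht0
      rw [zero_mul, h00]
    · rw [hk' (t * e t), mul_assoc] at ht
      exact mul_left_cancel₀ ht0 (ht.trans (mul_one t).symm)
  · filter_upwards [hright] with t ht
    rw [← hk']
    by_cases ht0 : t = 0
    · subst ht0
      rw [hk0, mul_comm, h00]
    · rw [hk' t, mul_assoc, ← hk' t] at ht
      exact mul_left_cancel₀ ht0 (ht.trans (mul_one t).symm)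

theorem norm_radialMap {κ : ℂ} (hκ : ‖κ‖ = 1) (e : ℝ → ℝ) (z : ℂ) :
    ‖radialMap κ e z‖ = ‖z‖ * |e ‖z‖| := by
  rw [radialMap, norm_mul, norm_mul, hκ, one_mul, Complex.norm_real, Real.norm_eq_abs]

theorem radialMap_radialMap {κ : ℂ} (hκ : ‖κ‖ = 1) {e e' : ℝ → ℝ} {z : ℂ} (he : 0 < e ‖z‖)
    (h : e ‖z‖ * e' (‖z‖ * e ‖z‖) = 1) : radialMap κ⁻¹ e' (radialMap κ e z) = z := by
  have hκ0 : κ ≠ 0 := by rw [← norm_ne_zero_iff, hκ]; exact one_ne_zero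
  rw [radialMap, norm_radialMap hκ, abs_of_pos he, radialMap]
  have : ((e ‖z‖ : ℝ) : ℂ) * ((e' (‖z‖ * e ‖z‖) : ℝ) : ℂ) = 1 := by exact_mod_cast h
  calc κ⁻¹ * (κ * z * (e ‖z‖ : ℂ)) * (e' (‖z‖ * e ‖z‖) : ℂ)
      = κ⁻¹ * κ * z * ((e ‖z‖ : ℂ) * (e' (‖z‖ * e ‖z‖) : ℂ)) := by ring
    _ = z := by rw [this, inv_mul_cancel₀ hκ0, one_mul, mul_one]

/-- A map `r e^{iθ} ↦ ρ(r) c e^{idθ}`, `|c| = 1`, is smoothly conjugate to `z ^ d`, if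
`ρ(r) = r ^ d σ(r)` with `σ` real-analytic up to `0` and positive. The conjugacy is the Böttcher
coordinate in the radial direction, followed by a rotation. -/
theorem smoothlyConjugateAtZero_of_radial {ρ σ : ℝ → ℝ} (hσ : AnalyticAt ℝ σ 0) (hσ0 : 0 < σ 0)
    {d : ℕ} (hd : 2 ≤ d) (hρ0 : ρ 0 = 0) (hρ : ∀ᶠ r in 𝓝[>] (0 : ℝ), ρ r = r ^ d * σ r) {c : ℂ}
    (hc : ‖c‖ = 1) :
    SmoothlyConjugateAtZero (fun z => (ρ ‖z‖ : ℂ) * (c * (z / (‖z‖ : ℂ)) ^ d))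
      (fun z => z ^ d) := by
  obtain ⟨e, he, he0, hfun⟩ := exists_boettcher hσ hσ0 hd
  obtain ⟨e', he', he'0, hinv, hinv'⟩ := he.exists_radial_inverse he0
  -- The rotation by `κ` turns the factor `c` into `1`, as `κ * c = κ ^ d`.
  obtain ⟨κ, hκc⟩ : ∃ κ : ℂ, κ ^ (d - 1) = c := IsAlgClosed.exists_pow_nat_eq _ (by omega)
  have hκ : ‖κ‖ = 1 := by
    have := congrArg norm hκc
    rw [norm_pow, hc] at this
    exact (pow_eq_one_iff_of_nonneg (norm_nonneg κ) (by omega)).1 this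
  have hκ' : ‖κ⁻¹‖ = 1 := by rw [norm_inv, hκ, inv_one]
  have hρ' : ∀ᶠ r in 𝓝 (0 : ℝ), 0 ≤ r → ρ r = r ^ d * σ r := by
    filter_upwards [eventually_nhdsWithin_iff.1 hρ] with r hr hr0
    rcases hr0.eq_or_lt with h | h
    · subst h
      rw [hρ0, zero_pow (by omega), zero_mul]
    · exact hr h
  have hsmall : ∀ᶠ r in 𝓝 (0 : ℝ), |r ^ (d - 1) * σ r| < 1 := by
    have : ContinuousAt (fun r : ℝ => |r ^ (d - 1) * σ r|) 0 :=
      ((continuousAt_id.pow (d - 1)).mul hσ.continuousAt).abs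
    refine this.eventually_lt_const ?_
    simp [zero_pow (by omega : d - 1 ≠ 0)]
  obtain ⟨δ₂, hδ₂, hball₂⟩ := Metric.eventually_nhds_iff_ball.1
    ((hinv'.and (he'.continuousAt.eventually_const_lt he'0)).and he'.eventually_analyticAt)
  have hball₂' : ∀ z ∈ Metric.ball (0 : ℂ) δ₂, (‖z‖ : ℝ) ∈ Metric.ball (0 : ℝ) δ₂ :=
    fun z hz => by simpa using hz
  have hmaps : ∀ᶠ z in 𝓝 (0 : ℂ), radialMap κ e z ∈ Metric.ball (0 : ℂ) δ₂ := by
    have h1 := (contDiffAt_one_radialMap_zero κ he).continuousAt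
    have h2 : radialMap κ e 0 = 0 := by simp [radialMap]
    rw [ContinuousAt, h2] at h1
    exact h1.eventually (Metric.ball_mem_nhds 0 hδ₂)
  have hall := (((hinv.and (he.continuousAt.eventually_const_lt he0)).and
    he.eventually_analyticAt).and hρ').and
    ((hsmall.and hfun).and (hσ.continuousAt.eventually_const_lt hσ0))
  obtain ⟨δ₁, hδ₁, hball₁⟩ := Metric.eventually_nhds_iff_ball.1 hall
  obtain ⟨δ₃, hδ₃, hball₃⟩ := Metric.eventually_nhds_iff_ball.1 hmaps
  set δ := min δ₁ δ₃ with hδ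
  have hδ0 : 0 < δ := lt_min hδ₁ hδ₃
  set V := Metric.ball (0 : ℂ) δ with hV
  have hV₁ : V ⊆ Metric.ball 0 δ₁ := Metric.ball_subset_ball (min_le_left _ _)
  have hV₃ : V ⊆ Metric.ball 0 δ₃ := Metric.ball_subset_ball (min_le_right _ _)
  have hV₁' : ∀ z ∈ V, (‖z‖ : ℝ) ∈ Metric.ball (0 : ℝ) δ₁ := fun z hz => by
    simpa using hV₁ hz
  set H := radialMap κ e with hH
  set K := radialMap κ⁻¹ e' with hK
  have hKH : ∀ z ∈ V, K (H z) = z := fun z hz =>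
    radialMap_radialMap hκ (hball₁ _ (hV₁' z hz)).1.1.1.2 (hball₁ _ (hV₁' z hz)).1.1.1.1
  have hHK : ∀ w ∈ Metric.ball (0 : ℂ) δ₂, H (K w) = w := fun w hw => by
    have := radialMap_radialMap hκ' (hball₂ _ (hball₂' w hw)).1.2 (hball₂ _ (hball₂' w hw)).1.1
    rwa [inv_inv] at this
  have hKs : SmoothInPolar K (Metric.ball 0 δ₂) :=
    smoothInPolar_radialMap κ⁻¹ (fun t ht => (hball₂ t ht).2) subset_rfl
  have hHs : SmoothInPolar H V :=
    smoothInPolar_radialMap κ (fun t ht => (hball₁ t ht).1.1.2) hV₁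
  -- The image `H '' V`, in a form that is visibly open.
  set W := Metric.ball (0 : ℂ) δ₂ ∩ K ⁻¹' V with hW
  have hWs : SmoothInPolar K W :=
    smoothInPolar_radialMap κ⁻¹ (fun t ht => (hball₂ t ht).2) Set.inter_subset_left
  let Φ : OpenPartialHomeomorph ℂ ℂ :=
    { toFun := H
      invFun := K
      source := V
      target := W
      map_source' := fun z hz => ⟨hball₃ z (hV₃ hz), by
        rw [Set.mem_preimage, hKH z hz]
        exact hz⟩
      map_target' := fun w hw => hw.2
      left_inv' := hKH
      right_inv' := fun w hw => hHK w hw.1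
      open_source := Metric.isOpen_ball
      open_target := hKs.1.continuousOn.isOpen_inter_preimage Metric.isOpen_ball
        Metric.isOpen_ball
      continuousOn_toFun := hHs.1.continuousOn
      continuousOn_invFun := hWs.1.continuousOn }
  refine ⟨Φ, Metric.mem_ball_self hδ0, ?_, hHs, hWs, ?_⟩
  · change H 0 = 0
    simp [hH, radialMap]
  intro z hz
  change (_ ∈ V) ∧ H _ = H z ^ d
  change z ∈ V at hz
  obtain ⟨⟨⟨⟨h1, h2⟩, -⟩, h3⟩, ⟨h4, h5⟩, hσp⟩ := hball₁ _ (hV₁' z hz)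
  specialize h3 (norm_nonneg z)
  by_cases hz0 : z = 0
  · subst hz0
    simp only [norm_zero, hρ0, Complex.ofReal_zero, zero_mul]
    refine ⟨hz, ?_⟩
    simp [hH, radialMap, zero_pow (by omega : d ≠ 0)]
  have hn0 : 0 < ‖z‖ := norm_pos_iff.2 hz0
  have hnc : (‖z‖ : ℂ) ≠ 0 := by exact_mod_cast hn0.ne'
  have hu : ‖z / (‖z‖ : ℂ)‖ = 1 := by
    rw [norm_div, Complex.norm_real, norm_norm, div_self hn0.ne']
  have hDn : ‖(ρ ‖z‖ : ℂ) * (c * (z / (‖z‖ : ℂ)) ^ d)‖ = |ρ ‖z‖| := by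
    rw [norm_mul, norm_mul, norm_pow, hu, hc, one_pow, mul_one, mul_one, Complex.norm_real,
      Real.norm_eq_abs]
  have hρz : ρ ‖z‖ = ‖z‖ * (‖z‖ ^ (d - 1) * σ ‖z‖) := by
    rw [h3, ← mul_assoc, ← pow_succ', Nat.sub_add_cancel (by omega)]
  have hDV : (ρ ‖z‖ : ℂ) * (c * (z / (‖z‖ : ℂ)) ^ d) ∈ V := by
    rw [hV, mem_ball_zero_iff] at hz ⊢
    rw [hDn, hρz, abs_mul, abs_of_pos hn0]
    exact (mul_le_of_le_one_right hn0.le h4.le).trans_lt hz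
  refine ⟨hDV, ?_⟩
  have hσz : 0 ≤ ρ ‖z‖ := by
    rw [h3]
    positivity
  rw [hH, radialMap, hDn, abs_of_nonneg hσz, h3]
  have h6 : (σ ‖z‖ : ℂ) * (e (‖z‖ ^ d * σ ‖z‖) : ℂ) = (e ‖z‖ : ℂ) ^ d := by exact_mod_cast h5
  have h7 : κ ^ d = κ * c := by
    rw [← hκc, ← pow_succ', Nat.sub_add_cancel (by omega)]
  simp only [radialMap]
  rw [mul_pow, mul_pow, ← h6, h7, h3, div_pow]
  push_cast
  field_simp

theorem proposition1p6 (f : ℂ → ℂ) (d : ℕ) (hd : 2 ≤ d)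
    (hf : AnalyticAt ℂ f 0) (hconst : ¬ ∀ᶠ z in 𝓝 (0 : ℂ), f z = f 0)
    (h0 : f 0 = 0) (hindex : localIndex f 0 = (d : ℕ∞)) :
    ∃ g : ℂ → ℂ, infinitesimalSpace f 0 = {g} ∧
      SmoothlyConjugateAtZero (asymptoticRepresentative f g) (fun z => z ^ d) := by
  obtain ⟨n, φ, ψ, hn, h⟩ := exists_localRoot hf hconst h0
  obtain rfl : n = d := by
    rw [h.localIndex_eq hn] at hindex
    exact_mod_cast hindex
  obtain ⟨σ, hσ, hσ0, hρ⟩ := h.exists_analyticAt_meanRadius hd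
  exact ⟨_, h.infinitesimalSpace_eq hn,
    smoothlyConjugateAtZero_of_radial hσ hσ0 hd (meanRadius_zero f 0) hρ h.norm_direction⟩
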